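/- Let $\mathcal{Y}$ be a finite set, let $\{f_\theta:\theta\in\Theta\}$ be a family of conditional probability mass functions $f_\theta(y|x)$ of $y\in\mathcal{Y}$ given $x\in\mathcal{X}$, let $p^x$ be a probability mass function (discrete setting) or density (continuous setting) on $\mathcal{X}$, and put $p_\theta(x,y)=f_\theta(y|x)p^x(x)$. Let $\varepsilon\in(0,1)$, $\theta,\underline{\theta}\in\Theta$, let $q$ be a joint probability mass function or density on $\mathcal{X}\times\mathcal{Y}$, and let $(x_1,y_1),(x_2,y_2),\dots$ be i.i.d. from the contaminated distribution $c=(1-\varepsilon)\,p_{\underline{\theta}}+\varepsilon\,q$. Fix $\eta>0$. (i) Discrete setting. Let $\mathcal{X}$ be finite and $\mathrm{TVD}(p,p')=\frac12\sum_{x\in\mathcal{X}}\sum_{y\in\mathcal{Y}}|p(x,y)-p'(x,y)|$. Let $\widehat p_n(x,y)=\frac1n\#\{i\le n:(x_i,y_i)=(x,y)\}$, $\widehat p^x_n(x)=\frac1n\#\{i\le n:x_i=x\}$ and $\widehat p_{\theta,n}(x,y)=f_\theta(y|x)\,\widehat p^x_n(x)$. Then, almost surely, there is an $N$ such that for all $n\ge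 N$ $$\bigl|\mathrm{TVD}(\widehat p_n,\widehat p_{\theta,n})-\mathrm{TVD}(p_{\underline\theta},p_\theta)\bigr|\le 2\varepsilon+\eta .$$ (ii) Kernel-smoothed continuous setting. Let $\mathcal{X}\subseteq\mathbb{R}^d$ be measurable, let $p^x$ be a density with respect to Lebesgue measure on $\mathcal{X}$ and $q$ a density with respect to the product of Lebesgue measure on $\mathcal{X}$ and counting measure on $\mathcal{Y}$ (so the true covariate marginal has a Lebesgue density), and let $\mathrm{TVD}(p,p')=\frac12\int_{\mathcal{X}}\sum_{y\in\mathcal{Y}}|p(x,y)-p'(x,y)|\,dx$. Let $K:\mathbb{R}^d\to\mathbb{R}$ be a kernel with $\int K(u)\,du=1$, and let $h_n>0$ with $h_n\to0$ and $n\,h_n^d\to\infty$. Let $$\widehat p^{h_n}_n(x,y)=\frac1n\sum_{i=1}^n \mathbf 1\{y_i=y\}\,\frac1{h_n^d}\,K\!\left(\frac{x_i-x}{h_n}\right),\qquad \widehat p^{x,h_n}_n(x)=\sum_{y\in\mathcal{Y}}\widehat p^{h_n}_n(x,y),\qquad \widehat p_{\theta,n,h_n}(x,y)=f_\theta(y|x)\,\widehat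 p^{x,h_n}_n(x),$$ and $n_y=\#\{i\le n:y_i=y\}$. Then, almost surely, there is an $N$ such that for all $n$ with $\min_{y\in\mathcal{Y}}n_y\ge N$ $$\bigl|\mathrm{TVD}(\widehat p^{h_n}_n,\widehat p_{\theta,n,h_n})-\mathrm{TVD}(p_{\underline\theta},p_\theta)\bigr|\le 2\varepsilon+\eta .$$ -/

import Mathlib

open MeasureTheory ProbabilityTheory Filter Topology

noncomputable section

namespace TVDRobust

/-! # Joint functions and the contamination model -/

section Common

variable {𝒳 𝒴 : Type*}

/-- The joint function `(x, y) ↦ f(y|x) m(x)` built from a conditional mass function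
`f` (written `f x y` for `f(y|x)`) and a marginal `m`. -/
def joint (f : 𝒳 → 𝒴 → ℝ) (m : 𝒳 → ℝ) (z : 𝒳 × 𝒴) : ℝ :=
  f z.1 z.2 * m z.1

/-- The `ε`-contamination `(1 - ε) p + ε q` of `p` by `q`. -/
def contaminated (ε : ℝ) (p q : 𝒳 × 𝒴 → ℝ) (z : 𝒳 × 𝒴) : ℝ :=
  (1 - ε) * p z + ε * q z

/-- The number `n_y` of indices `i < n` whose label in the data sequence `z` is `y`. -/
def labelCount [DecidableEq 𝒴] (z : ℕ → 𝒳 × 𝒴) (n : ℕ) (y : 𝒴) : ℕ :=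
  ((Finset.range n).filter fun i => (z i).2 = y).card

end Common

/-! # Discrete covariates -/

section Discrete

variable {𝒳 𝒴 : Type*} [Fintype 𝒳] [Fintype 𝒴] [DecidableEq 𝒳] [DecidableEq 𝒴]

/-- Total variation distance `(1/2) ∑_x ∑_y |p(x, y) - q(x, y)|`. -/
def tvdDiscrete (p q : 𝒳 × 𝒴 → ℝ) : ℝ :=
  (1 / 2) * ∑ x, ∑ y, |p (x, y) - q (x, y)|

/-- Joint empirical mass function of the first `n` terms of the data sequence `z`. -/
def empJoint (z : ℕ → 𝒳 × 𝒴) (n : ℕ) (w : 𝒳 × 𝒴) : ℝ :=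
  (1 / (n : ℝ)) * ∑ i ∈ Finset.range n, if z i = w then 1 else 0

/-- Empirical mass function of the covariates. -/
def empMarginal (z : ℕ → 𝒳 × 𝒴) (n : ℕ) (x : 𝒳) : ℝ :=
  (1 / (n : ℝ)) * ∑ i ∈ Finset.range n, if (z i).1 = x then 1 else 0

/-- The estimated total variation distance between the joint empirical mass function and
`f(y|x)` times the empirical marginal. -/
def estDiscrete (f : 𝒳 → 𝒴 → ℝ) (z : ℕ → 𝒳 × 𝒴) (n : ℕ) : ℝ :=
  tvdDiscrete (empJoint z n) (joint f (empMarginal z n))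

end Discrete

/-- `Z 0, Z 1, …` are i.i.d. with probability mass function `c`. -/
structure IsIIDOfPmf {Ω α : Type*} [MeasurableSpace Ω] [MeasurableSpace α]
    (P : Measure Ω) (c : α → ℝ) (Z : ℕ → Ω → α) : Prop where
  measurable : ∀ i, Measurable (Z i)
  indep : iIndepFun Z P
  law : ∀ i a, P.real (Z i ⁻¹' {a}) = c a

/-! # Continuous covariates in a subset of `ℝ^d` -/

section Continuous

variable {d : ℕ} {𝒴 : Type*} [Fintype 𝒴]

/-- `m` is a probability density on `S` with respect to Lebesgue measure. -/
structure IsDensityOn (S : Set (EuclideanSpace ℝ (Fin d)))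
    (m : EuclideanSpace ℝ (Fin d) → ℝ) : Prop where
  measurable : Measurable m
  nonneg : ∀ x ∈ S, 0 ≤ m x
  integral_eq_one : ∫ x in S, m x = 1

/-- `q` is a probability density on `S × 𝒴` with respect to Lebesgue measure times
counting measure. -/
structure IsJointDensityOn (S : Set (EuclideanSpace ℝ (Fin d)))
    (q : EuclideanSpace ℝ (Fin d) × 𝒴 → ℝ) : Prop where
  measurable : ∀ y, Measurable fun x => q (x, y)
  nonneg : ∀ x ∈ S, ∀ y, 0 ≤ q (x, y)
  integral_eq_one : ∫ x in S, ∑ y, q (x, y) = 1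

/-- `f(·|x)` is a probability mass function on `𝒴` for every `x ∈ S`, measurably in `x`. -/
structure IsCondPmfOn (S : Set (EuclideanSpace ℝ (Fin d)))
    (f : EuclideanSpace ℝ (Fin d) → 𝒴 → ℝ) : Prop where
  measurable : ∀ y, Measurable fun x => f x y
  mem_simplex : ∀ x ∈ S, f x ∈ stdSimplex ℝ 𝒴

/-- Total variation distance `(1/2) ∫_S ∑_y |p(x, y) - q(x, y)| dx`. -/
def tvdContinuous (S : Set (EuclideanSpace ℝ (Fin d)))
    (p q : EuclideanSpace ℝ (Fin d) × 𝒴 → ℝ) : ℝ :=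
  (1 / 2) * ∫ x in S, ∑ y, |p (x, y) - q (x, y)|

/-- Kernel-smoothed joint density
`(1/n) ∑_{i<n} δ_{y_i}(y) h^{-d} K((x_i - x)/h)`. -/
def kdeJoint [DecidableEq 𝒴] (K : EuclideanSpace ℝ (Fin d) → ℝ) (h : ℝ)
    (z : ℕ → EuclideanSpace ℝ (Fin d) × 𝒴) (n : ℕ)
    (w : EuclideanSpace ℝ (Fin d) × 𝒴) : ℝ :=
  (1 / (n : ℝ)) * ∑ i ∈ Finset.range n,
    (if (z i).2 = w.2 then 1 else 0) * ((1 / h ^ d) * K ((1 / h) • ((z i).1 - w.1)))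

/-- Covariate marginal of the kernel-smoothed joint density. -/
def kdeMarginal [DecidableEq 𝒴] (K : EuclideanSpace ℝ (Fin d) → ℝ) (h : ℝ)
    (z : ℕ → EuclideanSpace ℝ (Fin d) × 𝒴) (n : ℕ) (x : EuclideanSpace ℝ (Fin d)) : ℝ :=
  ∑ y, kdeJoint K h z n (x, y)

/-- The estimated total variation distance on `S × 𝒴` between the kernel-smoothed joint
density and `f(y|x)` times its covariate marginal. -/
def estContinuous [DecidableEq 𝒴] (S : Set (EuclideanSpace ℝ (Fin d)))
    (K : EuclideanSpace ℝ (Fin d) → ℝ) (h : ℝ) (f : EuclideanSpace ℝ (Fin d) → 𝒴 → ℝ)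
    (z : ℕ → EuclideanSpace ℝ (Fin d) × 𝒴) (n : ℕ) : ℝ :=
  tvdContinuous S (kdeJoint K h z n) (joint f (kdeMarginal K h z n))

end Continuous

/-- `Z 0, Z 1, …` are i.i.d. on `S × 𝒴` with density `c` with respect to Lebesgue measure
times counting measure. -/
structure IsIIDOfDensityOn {Ω 𝒴 : Type*} [MeasurableSpace Ω] [MeasurableSpace 𝒴] {d : ℕ}
    (P : Measure Ω) (S : Set (EuclideanSpace ℝ (Fin d)))
    (c : EuclideanSpace ℝ (Fin d) × 𝒴 → ℝ)
    (Z : ℕ → Ω → EuclideanSpace ℝ (Fin d) × 𝒴) : Prop where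
  measurable : ∀ i, Measurable (Z i)
  indep : iIndepFun Z P
  law : ∀ i, P.map (Z i) =
    (((volume : Measure (EuclideanSpace ℝ (Fin d))).restrict S).prod
      (Measure.count : Measure 𝒴)).withDensity fun w => ENNReal.ofReal (c w)

end TVDRobust

end

/-!
The estimated distance is the functional `D(p) = (1/2) ∫ ∑_y |p(x, y) - f(y|x) ∑_{y'} p(x, y')| dx`
evaluated at an estimate `p` of the contaminated distribution `c`, and the target is `D(p₀)`, where
`p₀` is the uncontaminated joint distribution. Since `f(·|x)` is a probability mass function,
`|D(p) - D(p')|` is at most the `L¹` distance of `p` and `p'`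
(`abs_tvd_joint_marginal_sub_le`). The `L¹` distance of `c` and `p₀` is `ε` times that of `q` and
`p₀`, hence at most `2 ε` (`abs_tvd_sub_le_of_contaminated`). What remains is the strong `L¹`
consistency of the estimate `p` of `c`.

For discrete covariates this is the strong law of large numbers for the indicators of the finitely
many points. For continuous covariates it is the theorem of Devroye that kernel estimates are
strongly `L¹` consistent for every density as soon as `h → 0` and `n hᵈ → ∞`, here for each label
separately (`ae_tendsto_integral_abs_mean_sub_density`). The kernel is only assumed integrable; it
may be signed, unbounded and of unbounded support.

* The `L¹` error is a function of the `n` observations that changes by at most `2 ‖K‖₁ / n` when one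
  observation is replaced, because rescaling and translating a kernel preserves its `L¹` norm. By
  McDiarmid's inequality its upper deviations from its mean have exponentially small
  probabilities, and by the Borel-Cantelli lemma it suffices that the mean tends to zero
  (`ae_tendsto_zero_of_bounded_differences`). This is needed since the rate of the mean may be
  arbitrarily slow.
* For a bounded kernel the mean is at most a variance term plus a bias term. The bias tends to zero
  by continuity of translations in `L¹` (`tendsto_lintegral_enorm_smoothing_sub`). The variance term
  is controlled on a set of finite measure by second moments of order `1 / (n hᵈ)`, and on the
  complement by first absolute moments, which are small there by the bias statement for `|K|`
  (`tendsto_lintegral_mean_sub_smoothing`).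
* A general kernel is approximated in `L¹` by a bounded one; the error this makes is bounded by the
  `L¹` distance of the two kernels, uniformly in `n` and in the sample
  (`tendsto_lintegral_mean_sub_density`).
-/

open scoped ENNReal

namespace TVDRobust

/-! ### Concentration of functions with bounded differences -/

section BoundedDifferences

/-- McDiarmid's inequality in exponential form: a function of `n` independent variables that changes
by at most `c` when one variable is changed is sub-Gaussian about its mean. The induction integrates
out the first variable: the averaged function inherits the bounded differences, and Hoeffding's
lemma handles the first variable. The constant is not optimal, since Hoeffding's lemma is applied on
an interval of length `2 c`. -/
theorem integral_exp_le_of_bounded_differences {α : Type*} [MeasurableSpace α]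
    (ν : Measure α) [IsProbabilityMeasure ν] {c B : ℝ} (t : ℝ) :
    ∀ (n : ℕ) (F : (Fin n → α) → ℝ), Measurable F → (∀ z, |F z| ≤ B) →
      (∀ z i a, |F (Function.update z i a) - F z| ≤ c) →
      ∫ z, Real.exp (t * (F z - ∫ w, F w ∂Measure.pi fun _ => ν)) ∂Measure.pi (fun _ => ν)
        ≤ Real.exp (n * (c ^ 2 * t ^ 2 / 2)) := by
  intro n
  induction n with
  | zero =>
    intro F hF hB hd
    have hconst : ∀ z, F z = F default := fun z => by rw [Subsingleton.elim z default]
    simp [hconst]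
  | succ n ih =>
    intro F hF hB hd
    set π : Measure (Fin n → α) := Measure.pi fun _ => ν with hπ
    have hmp := (measurePreserving_piFinSuccAbove (fun _ : Fin (n + 1) => ν) 0).symm
    have hint : ∀ Φ : (Fin (n + 1) → α) → ℝ,
        ∫ z, Φ z ∂Measure.pi (fun _ => ν) = ∫ p, Φ (Fin.cons p.1 p.2) ∂(ν.prod π) := by
      intro Φ
      rw [← hmp.integral_comp']
      simp [MeasurableEquiv.piFinSuccAbove_symm_apply, Fin.insertNthEquiv, hπ]
    have hcons : Measurable fun p : α × (Fin n → α) => (Fin.cons p.1 p.2 : Fin (n + 1) → α) := by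
      refine measurable_pi_iff.2 fun i => ?_
      refine Fin.cases ?_ (fun j => ?_) i
      · simpa using measurable_fst
      · exact (measurable_pi_apply j).comp measurable_snd
    have hFm : Measurable fun p : α × (Fin n → α) => F (Fin.cons p.1 p.2) := hF.comp hcons
    have hFi : Integrable (fun p : α × (Fin n → α) => F (Fin.cons p.1 p.2)) (ν.prod π) :=
      Integrable.of_bound hFm.aestronglyMeasurable B (ae_of_all _ fun p => hB _)
    have hFi1 : ∀ z, Integrable (fun a => F (Fin.cons a z)) ν := fun z =>
      Integrable.of_bound (hFm.comp measurable_prodMk_right).aestronglyMeasurable B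
        (ae_of_all _ fun p => hB _)
    set G : (Fin n → α) → ℝ := fun z => ∫ a, F (Fin.cons a z) ∂ν with hG
    have hGm : Measurable G :=
      (hFm.stronglyMeasurable.integral_prod_left' (μ := ν)).measurable
    have hGB : ∀ z, |G z| ≤ B := fun z => by
      simpa using norm_integral_le_of_norm_le_const (μ := ν) (f := fun a => F (Fin.cons a z))
        (ae_of_all _ fun a => hB _)
    have hGd : ∀ z i a, |G (Function.update z i a) - G z| ≤ c := fun z i a => by
      rw [hG]
      simp only
      rw [← integral_sub (hFi1 _) (hFi1 _)]
      simpa using norm_integral_le_of_norm_le_const (μ := ν) (C := c)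
        (f := fun b => F (Fin.cons b (Function.update z i a)) - F (Fin.cons b z))
        (ae_of_all _ fun b => by
          rw [Fin.cons_update]
          exact hd _ _ _)
    have hGF : ∫ z, F z ∂Measure.pi (fun _ => ν) = ∫ z, G z ∂π := by
      rw [hint, integral_prod_symm _ hFi]
    have hB0 : ∀ z : Fin (n + 1) → α, ∀ m, |m| ≤ B →
        ‖Real.exp (t * (F z - m))‖ ≤ Real.exp (|t| * (B + B)) := fun z m hm => by
      rw [Real.norm_eq_abs, Real.abs_exp]
      refine Real.exp_le_exp.2 ((le_abs_self _).trans ?_)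
      rw [abs_mul]
      have := abs_sub (F z) m
      have h1 := hB z
      gcongr
      linarith
    obtain ⟨a₀⟩ : Nonempty α := nonempty_of_isProbabilityMeasure ν
    -- Hoeffding's lemma in the first coordinate, the others being fixed
    have hin : ∀ z, ∫ a, Real.exp (t * (F (Fin.cons a z) - G z)) ∂ν
        ≤ Real.exp (c ^ 2 * t ^ 2 / 2) := fun z => by
      have h := (hasSubgaussianMGF_of_mem_Icc (μ := ν) (X := fun a => F (Fin.cons a z))
        (a := F (Fin.cons a₀ z) - c) (b := F (Fin.cons a₀ z) + c)
        (hFm.comp measurable_prodMk_right).aemeasurable (ae_of_all _ fun a => by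
          have := abs_le.1 (hd (Fin.cons a₀ z) 0 a)
          rw [Fin.update_cons_zero] at this
          constructor <;> linarith)).mgf_le t
      refine (le_of_eq ?_).trans (h.trans (le_of_eq ?_))
      · rfl
      · congr 3
        push_cast
        rw [show F (Fin.cons a₀ z) + c - (F (Fin.cons a₀ z) - c) = 2 * c by ring,
          Real.norm_eq_abs, div_pow, sq_abs]
        ring
    rw [hGF, hint]
    set m := ∫ z, G z ∂π with hm
    have hmB : |m| ≤ B := by
      simpa using norm_integral_le_of_norm_le_const (μ := π) (f := G) (ae_of_all _ hGB)
    rw [integral_prod_symm _ (Integrable.of_bound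
      ((hFm.sub_const m).const_mul t).exp.aestronglyMeasurable _
      (ae_of_all _ fun p => hB0 _ m hmB))]
    have hexpG : Integrable (fun z => Real.exp (t * (G z - m))) π := by
      refine Integrable.of_bound
        ((hGm.sub_const m).const_mul t).exp.aestronglyMeasurable
        (Real.exp (|t| * (B + B))) (ae_of_all _ fun z => ?_)
      rw [Real.norm_eq_abs, Real.abs_exp]
      refine Real.exp_le_exp.2 ((le_abs_self _).trans ?_)
      rw [abs_mul]
      have := abs_sub (G z) m
      have h1 := hGB z
      gcongr
      linarith
    calc ∫ z, ∫ a, Real.exp (t * (F (Fin.cons a z) - m)) ∂ν ∂π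
        ≤ ∫ z, Real.exp (t * (G z - m)) * Real.exp (c ^ 2 * t ^ 2 / 2) ∂π := by
          refine integral_mono_of_nonneg (ae_of_all _ fun z => integral_nonneg fun a =>
            (Real.exp_pos _).le) (hexpG.mul_const _) (ae_of_all _ fun z => ?_)
          have : ∀ a, Real.exp (t * (F (Fin.cons a z) - m))
              = Real.exp (t * (G z - m)) * Real.exp (t * (F (Fin.cons a z) - G z)) := fun a => by
            rw [← Real.exp_add]; ring_nf
          simp only [this, integral_const_mul]
          exact mul_le_mul_of_nonneg_left (hin z) (Real.exp_pos _).le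
      _ ≤ Real.exp (n * (c ^ 2 * t ^ 2 / 2)) * Real.exp (c ^ 2 * t ^ 2 / 2) := by
          rw [integral_mul_const]
          exact mul_le_mul_of_nonneg_right (ih G hGm hGB hGd) (Real.exp_pos _).le
      _ = Real.exp ((n + 1 : ℕ) * (c ^ 2 * t ^ 2 / 2)) := by
          rw [← Real.exp_add]; push_cast; ring_nf

theorem measureReal_ge_le_of_bounded_differences {Ω α : Type*} [MeasurableSpace Ω]
    [MeasurableSpace α] {P : Measure Ω} [IsProbabilityMeasure P] {ν : Measure α}
    [IsProbabilityMeasure ν] {Z : ℕ → Ω → α} (hZ : ∀ i, Measurable (Z i)) (hi : iIndepFun Z P)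
    (hν : ∀ i, P.map (Z i) = ν) {n : ℕ} {F : (Fin n → α) → ℝ} (hF : Measurable F) {B C : ℝ}
    (hB : ∀ z, |F z| ≤ B) (hC : 0 < C)
    (hd : ∀ z i a, |F (Function.update z i a) - F z| ≤ C / n) {s : ℝ} (hs : 0 ≤ s) :
    P.real {ω | (∫ ω', F (fun i => Z i ω') ∂P) + s ≤ F (fun i => Z i ω)}
      ≤ Real.exp (-(s ^ 2 / (2 * C ^ 2))) ^ n := by
  rcases Nat.eq_zero_or_pos n with rfl | hn
  · simp
  have hZm : Measurable fun ω => fun i : Fin n => Z i ω := measurable_pi_iff.2 fun i => hZ i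
  have hmap : P.map (fun ω => fun i : Fin n => Z i ω) = Measure.pi fun _ => ν := by
    have h := (iIndepFun_iff_map_fun_eq_pi_map (fun i : Fin n => (hZ i).aemeasurable)).1
      (hi.precomp Fin.val_injective)
    rw [h]
    simp [hν]
  have hnpos : (0 : ℝ) < n := by exact_mod_cast hn
  set m := ∫ ω', F (fun i => Z i ω') ∂P with hm
  have hm' : ∫ w, F w ∂Measure.pi (fun _ => ν) = m := by
    rw [← hmap, integral_map hZm.aemeasurable hF.aestronglyMeasurable]
  -- the minimiser of the exponent `-t s + t² C² / (2 n)` of the Chernoff bound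
  set t : ℝ := n * s / C ^ 2 with ht
  have hmgf := integral_exp_le_of_bounded_differences ν t n F hF hB hd
  rw [hm', ← hmap, integral_map hZm.aemeasurable
    ((hF.sub_const m).const_mul t).exp.aestronglyMeasurable] at hmgf
  have hX : Measurable fun ω => F (fun i => Z i ω) - m := (hF.comp hZm).sub_const m
  have hmB : |m| ≤ B := by
    simpa using norm_integral_le_of_norm_le_const (μ := P) (f := fun ω => F (fun i => Z i ω))
      (ae_of_all _ fun ω => hB _)
  have hXi : Integrable (fun ω => Real.exp (t * (F (fun i => Z i ω) - m))) P := by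
    refine Integrable.of_bound
      (hX.const_mul t).exp.aestronglyMeasurable
      (Real.exp (|t| * (B + B))) (ae_of_all _ fun z => ?_)
    rw [Real.norm_eq_abs, Real.abs_exp]
    refine Real.exp_le_exp.2 ((le_abs_self _).trans ?_)
    rw [abs_mul]
    have := abs_sub (F (fun i => Z i z)) m
    have h1 := hB (fun i => Z i z)
    gcongr
    linarith
  have hcher := measure_ge_le_exp_mul_mgf (μ := P) (X := fun ω => F (fun i => Z i ω) - m) s
    (t := t) (by positivity) hXi
  have hset : {ω | m + s ≤ F (fun i => Z i ω)} = {ω | s ≤ F (fun i => Z i ω) - m} := by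
    ext ω; simp only [Set.mem_ofPred_eq]; constructor <;> intro h <;> linarith
  rw [hset]
  refine hcher.trans ?_
  refine (mul_le_mul_of_nonneg_left hmgf (Real.exp_pos _).le).trans (le_of_eq ?_)
  rw [← Real.exp_add, ← Real.exp_nat_mul, ht]
  congr 1
  field_simp
  ring

/-- Nonnegative functionals of `n` i.i.d. observations with differences of order `1 / n` tend to zero
almost surely as soon as their means tend to zero, at whatever rate. -/
theorem ae_tendsto_zero_of_bounded_differences {Ω α : Type*} [MeasurableSpace Ω]
    [MeasurableSpace α] {P : Measure Ω} [IsProbabilityMeasure P] {ν : Measure α}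
    [IsProbabilityMeasure ν] {Z : ℕ → Ω → α} (hZ : ∀ i, Measurable (Z i)) (hi : iIndepFun Z P)
    (hν : ∀ i, P.map (Z i) = ν) {F : ∀ n : ℕ, (Fin n → α) → ℝ} (hF : ∀ n, Measurable (F n))
    (hpos : ∀ n z, 0 ≤ F n z) {B C : ℝ} (hB : ∀ n z, F n z ≤ B) (hC : 0 < C)
    (hd : ∀ n z i a, |F n (Function.update z i a) - F n z| ≤ C / n)
    (hlim : Tendsto (fun n => ∫ ω, F n (fun i => Z i ω) ∂P) atTop (𝓝 0)) :
    ∀ᵐ ω ∂P, Tendsto (fun n => F n (fun i => Z i ω)) atTop (𝓝 0) := by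
  have key : ∀ k : ℕ, ∀ᵐ ω ∂P, ∀ᶠ n in atTop, F n (fun i => Z i ω) < 1 / ((k : ℝ) + 1) := by
    intro k
    set s : ℝ := 1 / ((k : ℝ) + 1) / 2 with hs
    have hspos : 0 < s := by positivity
    have hlt : Real.exp (-(s ^ 2 / (2 * C ^ 2))) < 1 := by
      rw [Real.exp_lt_one_iff]
      have : 0 < s ^ 2 / (2 * C ^ 2) := by positivity
      linarith
    have hsum := summable_geometric_of_lt_one (Real.exp_pos _).le hlt
    have hfin : ∑' n, P {ω | (∫ ω', F n (fun i => Z i ω') ∂P) + s ≤ F n (fun i => Z i ω)} ≠ ⊤ := by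
      refine ne_top_of_le_ne_top hsum.tsum_ofReal_ne_top (ENNReal.tsum_le_tsum fun n => ?_)
      rw [← ENNReal.ofReal_toReal (measure_ne_top P _)]
      exact ENNReal.ofReal_le_ofReal (measureReal_ge_le_of_bounded_differences hZ hi hν (hF n)
        (fun z => by rw [abs_of_nonneg (hpos n z)]; exact hB n z) hC (hd n) hspos.le)
    filter_upwards [ae_eventually_notMem hfin] with ω hω
    filter_upwards [hω, hlim.eventually (gt_mem_nhds hspos)] with n h1 h2
    rw [not_le] at h1
    have : 1 / ((k : ℝ) + 1) = s + s := by rw [hs]; ring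
    linarith
  filter_upwards [ae_all_iff.2 key] with ω hω
  refine tendsto_order.2 ⟨fun a ha => Eventually.of_forall fun n => ha.trans_le (hpos n _),
    fun a ha => ?_⟩
  obtain ⟨k, hk⟩ := exists_nat_one_div_lt ha
  exact (hω k).mono fun n hn => hn.trans hk

end BoundedDifferences

/-! ### Scaled kernels and approximate identities -/

section ApproximateIdentity

variable {E : Type*} [NormedAddCommGroup E] [NormedSpace ℝ E]

/-- The kernel `u ↦ h⁻ᵈ K(u / h)` of bandwidth `h`, where `d` is the dimension of the space. -/
noncomputable def scaledKernel (K : E → ℝ) (h : ℝ) (u : E) : ℝ :=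
  (1 / h ^ Module.finrank ℝ E) * K ((1 / h) • u)

theorem abs_scaledKernel (K : E → ℝ) {h : ℝ} (hh : 0 < h) (u : E) :
    |scaledKernel K h u| = scaledKernel (fun u => |K u|) h u := by
  rw [scaledKernel, scaledKernel, abs_mul, abs_of_nonneg (by positivity)]

variable [MeasurableSpace E] [BorelSpace E]

theorem measurable_scaledKernel {K : E → ℝ} (hK : Measurable K) (h : ℝ) :
    Measurable (scaledKernel K h) :=
  (hK.comp (measurable_const_smul (1 / h))).const_mul _

variable [FiniteDimensional ℝ E] (μ : Measure E) [μ.IsAddHaarMeasure]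

theorem integral_scaledKernel_sub_mul (K g : E → ℝ) {h : ℝ} (hh : 0 < h) (x : E) :
    ∫ t, scaledKernel K h (t - x) * g t ∂μ = ∫ u, K u * g (h • u + x) ∂μ := by
  have h1 := Measure.integral_comp_smul_of_nonneg μ
    (fun s => K ((1 / h) • s) * g (s + x)) h (hR := hh.le)
  have h2 := integral_add_right_eq_self (μ := μ) (fun t => scaledKernel K h (t - x) * g t) x
  rw [← h2]
  simp only [add_sub_cancel_right, scaledKernel, mul_assoc, integral_const_mul]
  simp only [smul_smul, one_div, inv_mul_cancel₀ hh.ne', one_smul, smul_eq_mul] at h1 ⊢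
  rw [h1]

theorem lintegral_comp_smul (f : E → ℝ≥0∞) {h : ℝ} (hh : 0 < h) :
    ∫⁻ u, f ((1 / h) • u) ∂μ = ENNReal.ofReal (h ^ Module.finrank ℝ E) * ∫⁻ u, f u ∂μ := by
  have hne : (1 / h) ≠ 0 := by positivity
  have hemb : MeasurableEmbedding fun u : E => (1 / h) • u :=
    (Homeomorph.smulOfNeZero (1 / h) hne).measurableEmbedding
  rw [← hemb.lintegral_map, Measure.map_addHaar_smul μ hne, lintegral_smul_measure, smul_eq_mul]
  congr 2
  rw [one_div, inv_pow, inv_inv, abs_of_nonneg (by positivity)]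

theorem lintegral_enorm_scaledKernel (K : E → ℝ) {h : ℝ} (hh : 0 < h) :
    ∫⁻ u, ‖scaledKernel K h u‖ₑ ∂μ = ∫⁻ u, ‖K u‖ₑ ∂μ := by
  simp only [scaledKernel, enorm_mul]
  rw [lintegral_const_mul' _ _ enorm_ne_top, lintegral_comp_smul μ (fun u => ‖K u‖ₑ) hh, ← mul_assoc,
    Real.enorm_of_nonneg (by positivity), ← ENNReal.ofReal_mul (by positivity),
    one_div_mul_cancel (by positivity), ENNReal.ofReal_one, one_mul]

theorem lintegral_enorm_sq_scaledKernel (K : E → ℝ) {h : ℝ} (hh : 0 < h) :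
    ∫⁻ u, ‖scaledKernel K h u‖ₑ ^ 2 ∂μ
      = ENNReal.ofReal (1 / h ^ Module.finrank ℝ E) * ∫⁻ u, ‖K u‖ₑ ^ 2 ∂μ := by
  simp only [scaledKernel, enorm_mul, mul_pow]
  rw [lintegral_const_mul' _ _ (by simp), lintegral_comp_smul μ (fun u => ‖K u‖ₑ ^ 2) hh,
    ← mul_assoc, Real.enorm_of_nonneg (by positivity), ← ENNReal.ofReal_pow (by positivity),
    ← ENNReal.ofReal_mul (by positivity)]
  congr 2
  field_simp

theorem integrable_scaledKernel {K : E → ℝ} (hK : Measurable K) (hKi : Integrable K μ) {h : ℝ}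
    (hh : 0 < h) : Integrable (scaledKernel K h) μ := by
  refine ⟨(measurable_scaledKernel hK h).aestronglyMeasurable, ?_⟩
  rw [HasFiniteIntegral, lintegral_enorm_scaledKernel μ K hh]
  exact hKi.2

/-- Translations act continuously on `L¹`. -/
theorem tendsto_lintegral_enorm_translate_sub {g : E → ℝ} (hg : Integrable g μ) :
    Tendsto (fun v => ∫⁻ x, ‖g (v + x) - g x‖ₑ ∂μ) (𝓝 0) (𝓝 0) := by
  have hg1 : MemLp g 1 μ := memLp_one_iff_integrable.2 hg
  have : Fact ((1 : ℝ≥0∞) ≠ ∞) := ⟨ENNReal.one_ne_top⟩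
  have hcont : Continuous fun v : E => DomAddAct.mk v +ᵥ hg1.toLp g :=
    (continuous_id.vadd continuous_const).comp
      (DomAddAct.continuous_mk (M := E))
  have h0 := hcont.tendsto 0
  simp only [DomAddAct.mk_zero, zero_vadd] at h0
  rw [tendsto_iff_edist_tendsto_0] at h0
  refine h0.congr fun v => ?_
  rw [DomAddAct.mk_vadd_toLp, Lp.edist_toLp_toLp, eLpNorm_one_eq_lintegral_enorm]
  rfl

/-- Smoothing with the scaled kernels converges in `L¹` to `g` times the integral of the kernel.
Boundedness of the kernel makes the smoothed function well defined at every point. -/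
theorem tendsto_lintegral_enorm_smoothing_sub {K g : E → ℝ} (hK : Measurable K)
    (hKi : Integrable K μ) {M : ℝ} (hM : ∀ u, |K u| ≤ M) (hg : Measurable g)
    (hgi : Integrable g μ) {h : ℕ → ℝ} (hpos : ∀ n, 0 < h n) (hlim : Tendsto h atTop (𝓝 0)) :
    Tendsto (fun n => ∫⁻ x, ‖∫ t, scaledKernel K (h n) (t - x) * g t ∂μ - (∫ u, K u ∂μ) * g x‖ₑ ∂μ)
      atTop (𝓝 0) := by
  set ω : E → ℝ≥0∞ := fun v => ∫⁻ x, ‖g (v + x) - g x‖ₑ ∂μ with hω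
  have hωm : Measurable ω := by
    have : Measurable fun p : E × E => ‖g (p.1 + p.2) - g p.2‖ₑ :=
      ((hg.comp (measurable_fst.add measurable_snd)).sub (hg.comp measurable_snd)).enorm
    exact this.lintegral_prod_right'
  have hω2 : ∀ v, ω v ≤ 2 * ∫⁻ x, ‖g x‖ₑ ∂μ := fun v => by
    calc ω v ≤ ∫⁻ x, (‖g (v + x)‖ₑ + ‖g x‖ₑ) ∂μ := lintegral_mono fun x => enorm_sub_le
      _ = 2 * ∫⁻ x, ‖g x‖ₑ ∂μ := by
        rw [lintegral_add_right _ hg.enorm, lintegral_add_left_eq_self (μ := μ) (fun x => ‖g x‖ₑ) v,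
          two_mul]
  -- Minkowski's integral inequality after the substitution `t = h u + x`
  have hbound : ∀ n, ∫⁻ x, ‖∫ t, scaledKernel K (h n) (t - x) * g t ∂μ - (∫ u, K u ∂μ) * g x‖ₑ ∂μ
      ≤ ∫⁻ u, ‖K u‖ₑ * ω (h n • u) ∂μ := by
    intro n
    have hpt : ∀ x, ∫ t, scaledKernel K (h n) (t - x) * g t ∂μ - (∫ u, K u ∂μ) * g x
        = ∫ u, K u * (g (h n • u + x) - g x) ∂μ := by
      intro x
      have hi : Integrable (fun u => g (h n • u + x)) μ :=
        (hgi.comp_add_right x).comp_smul (hpos n).ne'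
      rw [integral_scaledKernel_sub_mul μ K g (hpos n), ← integral_mul_const, ← integral_sub]
      · simp only [mul_sub]
      · exact hi.bdd_mul hK.aestronglyMeasurable (ae_of_all _ fun u => hM u)
      · exact hKi.mul_const _
    have hmeas : Measurable fun p : E × E => ‖K p.2‖ₑ * ‖g (h n • p.2 + p.1) - g p.1‖ₑ := by
      have h1 : Measurable fun p : E × E => h n • p.2 + p.1 :=
        (measurable_snd.const_smul (h n)).add measurable_fst
      exact (hK.comp measurable_snd).enorm.mul ((hg.comp h1).sub (hg.comp measurable_fst)).enorm
    calc ∫⁻ x, ‖∫ t, scaledKernel K (h n) (t - x) * g t ∂μ - (∫ u, K u ∂μ) * g x‖ₑ ∂μ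
        ≤ ∫⁻ x, ∫⁻ u, ‖K u‖ₑ * ‖g (h n • u + x) - g x‖ₑ ∂μ ∂μ := by
          refine lintegral_mono fun x => ?_
          rw [hpt]
          refine (enorm_integral_le_lintegral_enorm _).trans (le_of_eq ?_)
          simp only [enorm_mul]
      _ = ∫⁻ u, ∫⁻ x, ‖K u‖ₑ * ‖g (h n • u + x) - g x‖ₑ ∂μ ∂μ :=
          lintegral_lintegral_swap hmeas.aemeasurable
      _ = ∫⁻ u, ‖K u‖ₑ * ω (h n • u) ∂μ := by
          refine lintegral_congr fun u => ?_
          rw [lintegral_const_mul' _ _ enorm_ne_top]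
  have hdom : Tendsto (fun n => ∫⁻ u, ‖K u‖ₑ * ω (h n • u) ∂μ) atTop (𝓝 (∫⁻ _, 0 ∂μ)) := by
    refine tendsto_lintegral_of_dominated_convergence
      (fun u => ‖K u‖ₑ * (2 * ∫⁻ x, ‖g x‖ₑ ∂μ)) (fun n => ?_) (fun n => ?_) ?_ ?_
    · exact hK.enorm.mul (hωm.comp (measurable_const_smul (h n)))
    · exact ae_of_all _ fun u => mul_le_mul_right (hω2 _) _
    · rw [lintegral_mul_const _ hK.enorm]
      exact ENNReal.mul_ne_top hKi.2.ne (ENNReal.mul_ne_top (by simp) hgi.2.ne)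
    · refine ae_of_all _ fun u => ?_
      have h1 : Tendsto (fun n => h n • u) atTop (𝓝 0) := by
        simpa using hlim.smul_const u
      have h2 := (tendsto_lintegral_enorm_translate_sub μ hgi).comp h1
      simpa using ENNReal.Tendsto.const_mul h2 (Or.inr (enorm_ne_top (x := K u)))
  rw [lintegral_zero] at hdom
  exact tendsto_of_tendsto_of_tendsto_of_le_of_le tendsto_const_nhds hdom (fun _ => zero_le)
    hbound

end ApproximateIdentity

/-! ### Moments of sample means -/

section SampleMean

variable {Ω : Type*} [MeasurableSpace Ω] {P : Measure Ω} [IsProbabilityMeasure P]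

theorem integral_sq_sampleMean_sub_le {X : ℕ → Ω → ℝ} (hX : ∀ i, Measurable (X i)) {M m v : ℝ}
    (hM : ∀ i ω, |X i ω| ≤ M) (hind : Pairwise fun i j => IndepFun (X i) (X j) P)
    (hm : ∀ i, ∫ ω, X i ω ∂P = m) (hv : ∀ i, ∫ ω, X i ω ^ 2 ∂P ≤ v) {n : ℕ} (hn : 0 < n) :
    ∫ ω, ((1 / (n : ℝ)) * ∑ i ∈ Finset.range n, X i ω - m) ^ 2 ∂P ≤ v / n := by
  have hi : ∀ i, Integrable (X i) P := fun i =>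
    Integrable.of_bound (hX i).aestronglyMeasurable M (ae_of_all _ (hM i))
  have hn' : (n : ℝ) ≠ 0 := by positivity
  have hmean : ∫ ω, (1 / (n : ℝ)) * ∑ i ∈ Finset.range n, X i ω ∂P = m := by
    rw [integral_const_mul, integral_finsetSum _ fun i _ => hi i]
    simp only [hm, Finset.sum_const, Finset.card_range, nsmul_eq_mul]
    field_simp
  have hmeas : Measurable fun ω => (1 / (n : ℝ)) * ∑ i ∈ Finset.range n, X i ω :=
    (Finset.measurable_fun_sum _ fun i _ => hX i).const_mul _
  have hvar := variance_eq_integral (μ := P) hmeas.aemeasurable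
  rw [hmean] at hvar
  rw [← hvar, variance_const_mul]
  have hsum : Var[fun ω => ∑ i ∈ Finset.range n, X i ω; P] = ∑ i ∈ Finset.range n, Var[X i; P] := by
    rw [← IndepFun.variance_sum (fun i _ => MemLp.of_bound (hX i).aestronglyMeasurable M
      (ae_of_all _ (hM i))) (fun i _ j _ hij => hind hij)]
    congr 1
    ext ω
    simp
  rw [hsum]
  have hle : ∑ i ∈ Finset.range n, Var[X i; P] ≤ n * v := by
    refine (Finset.sum_le_sum fun i _ =>
      (variance_le_expectation_sq (hX i).aestronglyMeasurable).trans (hv i)).trans (le_of_eq ?_)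
    simp
  calc (1 / (n : ℝ)) ^ 2 * ∑ i ∈ Finset.range n, Var[X i; P] ≤ (1 / (n : ℝ)) ^ 2 * (n * v) := by
        gcongr
    _ = v / n := by field_simp

/-- The first absolute moment of a centred sample mean, bounded through its variance by
`|a| ≤ s + a² / s`. As `s` is free, no square root of the variance appears and the bound can be
integrated over a parameter. -/
theorem integral_abs_sampleMean_sub_le {X : ℕ → Ω → ℝ} (hX : ∀ i, Measurable (X i)) {M m v : ℝ}
    (hM : ∀ i ω, |X i ω| ≤ M) (hind : Pairwise fun i j => IndepFun (X i) (X j) P)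
    (hm : ∀ i, ∫ ω, X i ω ∂P = m) (hv : ∀ i, ∫ ω, X i ω ^ 2 ∂P ≤ v) {n : ℕ} (hn : 0 < n)
    {s : ℝ} (hs : 0 < s) :
    ∫ ω, |(1 / (n : ℝ)) * ∑ i ∈ Finset.range n, X i ω - m| ∂P ≤ s + 1 / (s * n) * v := by
  have hmeas : Measurable fun ω => (1 / (n : ℝ)) * ∑ i ∈ Finset.range n, X i ω - m :=
    ((Finset.measurable_fun_sum _ fun i _ => hX i).const_mul _).sub_const m
  have hb : ∀ ω, |(1 / (n : ℝ)) * ∑ i ∈ Finset.range n, X i ω - m| ≤ M + |m| := by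
    intro ω
    refine (abs_sub _ _).trans (add_le_add_left ?_ _)
    rw [abs_mul, abs_of_pos (by positivity), one_div, inv_mul_le_iff₀ (by positivity)]
    refine (Finset.abs_sum_le_sum_abs _ _).trans ((Finset.sum_le_sum fun i _ => hM i ω).trans ?_)
    simp
  have hi : Integrable (fun ω => (1 / (n : ℝ)) * ∑ i ∈ Finset.range n, X i ω - m) P :=
    Integrable.of_bound hmeas.aestronglyMeasurable _ (ae_of_all _ hb)
  have hi2 : Integrable (fun ω => ((1 / (n : ℝ)) * ∑ i ∈ Finset.range n, X i ω - m) ^ 2) P := by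
    refine Integrable.of_bound (hmeas.pow_const 2).aestronglyMeasurable ((M + |m|) ^ 2)
      (ae_of_all _ fun ω => ?_)
    rw [norm_pow]
    exact pow_le_pow_left₀ (norm_nonneg _) (hb ω) 2
  calc ∫ ω, |(1 / (n : ℝ)) * ∑ i ∈ Finset.range n, X i ω - m| ∂P
      ≤ ∫ ω, (s + 1 / s * ((1 / (n : ℝ)) * ∑ i ∈ Finset.range n, X i ω - m) ^ 2) ∂P := by
        refine integral_mono hi.abs ((integrable_const _).add (hi2.const_mul _)) fun ω => ?_
        set a := (1 / (n : ℝ)) * ∑ i ∈ Finset.range n, X i ω - m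
        simp only
        rw [← sub_nonneg]
        have h1 : s + 1 / s * a ^ 2 - |a| = ((|a| - s / 2) ^ 2 + 3 / 4 * s ^ 2) / s := by
          rw [← sq_abs a]; field_simp; ring
        rw [h1]
        positivity
    _ = s + 1 / s * ∫ ω, ((1 / (n : ℝ)) * ∑ i ∈ Finset.range n, X i ω - m) ^ 2 ∂P := by
        rw [integral_add (integrable_const _) (hi2.const_mul _), integral_const_mul]
        simp
    _ ≤ s + 1 / s * (v / n) := by
        gcongr
        exact integral_sq_sampleMean_sub_le hX hM hind hm hv hn
    _ = s + 1 / (s * n) * v := by field_simp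

theorem integral_abs_sampleMean_sub_le_two_mul {X : ℕ → Ω → ℝ} (hX : ∀ i, Integrable (X i) P)
    {m e : ℝ} (hm : ∀ i, ∫ ω, X i ω ∂P = m) (he : ∀ i, ∫ ω, |X i ω| ∂P ≤ e) {n : ℕ} (hn : 0 < n) :
    ∫ ω, |(1 / (n : ℝ)) * ∑ i ∈ Finset.range n, X i ω - m| ∂P ≤ 2 * e := by
  have hme : |m| ≤ e := by
    rw [← hm 0]
    exact (abs_integral_le_integral_abs).trans (he 0)
  have hs : Integrable (fun ω => ∑ i ∈ Finset.range n, |X i ω|) P :=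
    integrable_finsetSum _ fun i _ => (hX i).abs
  calc ∫ ω, |(1 / (n : ℝ)) * ∑ i ∈ Finset.range n, X i ω - m| ∂P
      ≤ ∫ ω, ((1 / (n : ℝ)) * ∑ i ∈ Finset.range n, |X i ω| + e) ∂P := by
        refine integral_mono
          (((integrable_finsetSum _ fun i _ => hX i).const_mul _).sub (integrable_const m)).abs
          ((hs.const_mul _).add (integrable_const e)) fun ω => ?_
        refine (abs_sub _ _).trans (add_le_add ?_ hme)
        rw [abs_mul, abs_of_pos (by positivity)]
        gcongr
        exact Finset.abs_sum_le_sum_abs _ _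
    _ = (1 / (n : ℝ)) * ∑ i ∈ Finset.range n, ∫ ω, |X i ω| ∂P + e := by
        rw [integral_add (hs.const_mul _) (integrable_const e), integral_const_mul,
          integral_finsetSum _ fun i _ => (hX i).abs]
        simp
    _ ≤ (1 / (n : ℝ)) * (n * e) + e := by
        gcongr
        refine (Finset.sum_le_sum fun i _ => he i).trans (le_of_eq ?_)
        simp
    _ = 2 * e := by
        have : (n : ℝ) ≠ 0 := by positivity
        field_simp
        ring

end SampleMean

/-! ### Labelled kernels and label densities -/

section LabelDensity

variable {E : Type*} [MeasurableSpace E] {𝒴 : Type*} [MeasurableSpace 𝒴]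

/-- `g` is the density with respect to `μ` of the part of the law `ν` of a labelled covariate that
carries the label `y`. Its total mass is the probability of `y`. -/
def IsLabelDensity (ν : Measure (E × 𝒴)) (μ : Measure E) (y : 𝒴) (g : E → ℝ) : Prop :=
  (ν.restrict (Prod.snd ⁻¹' {y})).map Prod.fst = μ.withDensity fun t => ENNReal.ofReal (g t)

variable [MeasurableSingletonClass 𝒴] [DecidableEq 𝒴]

theorem IsLabelDensity.integral_labelled {ν : Measure (E × 𝒴)} {μ : Measure E} {y : 𝒴} {g : E → ℝ}
    (h : IsLabelDensity ν μ y g) (hg : Measurable g) (hg0 : ∀ t, 0 ≤ g t) {φ : E → ℝ}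
    (hφ : Measurable φ) :
    ∫ w, (if w.2 = y then 1 else 0) * φ w.1 ∂ν = ∫ t, φ t * g t ∂μ := by
  have hs : MeasurableSet (Prod.snd ⁻¹' {y} : Set (E × 𝒴)) :=
    measurable_snd (measurableSet_singleton y)
  have h1 : ∀ w : E × 𝒴, (if w.2 = y then (1 : ℝ) else 0) * φ w.1
      = (Prod.snd ⁻¹' {y} : Set (E × 𝒴)).indicator (fun w => φ w.1) w := fun w => by
    by_cases hw : w.2 = y <;> simp [hw]
  simp only [h1]
  rw [integral_indicator hs,
    ← integral_map (φ := Prod.fst) measurable_fst.aemeasurable hφ.aestronglyMeasurable, h,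
    integral_withDensity_eq_integral_toReal_smul hg.ennreal_ofReal (by simp)]
  refine integral_congr_ae (ae_of_all _ fun t => ?_)
  simp only [ENNReal.toReal_ofReal (hg0 t), smul_eq_mul]
  ring

end LabelDensity

section LabelledKernel

variable {E : Type*} [NormedAddCommGroup E] {𝒴 : Type*} [DecidableEq 𝒴]

/-- The contribution at `x` of an observation `w` to the smoothed density of the covariates with
label `y`: it is `k(w.1 - x)` if `w` has label `y`, and zero otherwise. -/
def labelledKernel (y : 𝒴) (k : E → ℝ) (w : E × 𝒴) (x : E) : ℝ :=
  (if w.2 = y then 1 else 0) * k (w.1 - x)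

theorem abs_labelledKernel_le (y : 𝒴) (k : E → ℝ) (w : E × 𝒴) (x : E) :
    |labelledKernel y k w x| ≤ |k (w.1 - x)| := by
  unfold labelledKernel
  split_ifs <;> simp

variable [MeasurableSpace E] [BorelSpace E]

theorem lintegral_enorm_labelledKernel_le (μ : Measure E) [μ.IsAddLeftInvariant] [μ.IsNegInvariant]
    (y : 𝒴) (k : E → ℝ) (w : E × 𝒴) :
    ∫⁻ x, ‖labelledKernel y k w x‖ₑ ∂μ ≤ ∫⁻ u, ‖k u‖ₑ ∂μ := by
  rw [← lintegral_sub_left_eq_self (μ := μ) (fun u => ‖k u‖ₑ) w.1]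
  exact lintegral_mono fun x => enorm_le_iff_norm_le.2 (abs_labelledKernel_le y k w x)

theorem integrable_labelledKernel_right {μ : Measure E}
    [μ.IsAddLeftInvariant] [μ.IsNegInvariant] (y : 𝒴) {k : E → ℝ} (hk : Integrable k μ)
    (w : E × 𝒴) : Integrable (labelledKernel y k w) μ :=
  (hk.comp_sub_left w.1).const_mul _

theorem integral_abs_labelledKernel_le {μ : Measure E}
    [μ.IsAddLeftInvariant] [μ.IsNegInvariant] (y : 𝒴) {k : E → ℝ} (hk : Integrable k μ)
    (w : E × 𝒴) : ∫ x, |labelledKernel y k w x| ∂μ ≤ ∫ u, |k u| ∂μ := by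
  rw [← integral_sub_left_eq_self (fun u => |k u|) μ w.1]
  exact integral_mono (integrable_labelledKernel_right y hk w).abs (hk.comp_sub_left w.1).abs
    fun x => abs_labelledKernel_le y k w x

variable [MeasurableSpace 𝒴] [MeasurableSingletonClass 𝒴]

theorem IsLabelDensity.integral_labelledKernel {ν : Measure (E × 𝒴)} {μ : Measure E} {y : 𝒴}
    {g : E → ℝ} (h : IsLabelDensity ν μ y g) (hg : Measurable g) (hg0 : ∀ t, 0 ≤ g t) {k : E → ℝ}
    (hk : Measurable k) (x : E) :
    ∫ w, labelledKernel y k w x ∂ν = ∫ t, k (t - x) * g t ∂μ :=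
  h.integral_labelled hg hg0 (φ := fun t => k (t - x)) (hk.comp (measurable_id.sub_const x))

theorem IsLabelDensity.integral_abs_labelledKernel {ν : Measure (E × 𝒴)} {μ : Measure E} {y : 𝒴}
    {g : E → ℝ} (h : IsLabelDensity ν μ y g) (hg : Measurable g) (hg0 : ∀ t, 0 ≤ g t) {k : E → ℝ}
    (hk : Measurable k) (x : E) :
    ∫ w, |labelledKernel y k w x| ∂ν = ∫ t, |k (t - x)| * g t ∂μ := by
  rw [← h.integral_labelled hg hg0 (φ := fun t => |k (t - x)|)
    (hk.comp (measurable_id.sub_const x)).abs]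
  refine integral_congr_ae (ae_of_all _ fun w => ?_)
  simp only [labelledKernel]
  split_ifs <;> simp

theorem IsLabelDensity.integral_sq_labelledKernel {ν : Measure (E × 𝒴)} {μ : Measure E} {y : 𝒴}
    {g : E → ℝ} (h : IsLabelDensity ν μ y g) (hg : Measurable g) (hg0 : ∀ t, 0 ≤ g t) {k : E → ℝ}
    (hk : Measurable k) (x : E) :
    ∫ w, labelledKernel y k w x ^ 2 ∂ν = ∫ t, k (t - x) ^ 2 * g t ∂μ := by
  rw [← h.integral_labelled hg hg0 (φ := fun t => k (t - x) ^ 2)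
    ((hk.comp (measurable_id.sub_const x)).pow_const 2)]
  refine integral_congr_ae (ae_of_all _ fun w => ?_)
  simp only [labelledKernel]
  split_ifs <;> simp

variable [SecondCountableTopology E]

theorem measurable_labelledKernel (y : 𝒴) {k : E → ℝ} (hk : Measurable k) :
    Measurable fun p : (E × 𝒴) × E => labelledKernel y k p.1 p.2 := by
  refine Measurable.mul ?_ (hk.comp (measurable_fst.fst.sub measurable_snd))
  exact Measurable.ite (measurable_fst.snd (measurableSet_singleton y))
    measurable_const measurable_const

theorem measurable_labelledKernel_left (y : 𝒴) {k : E → ℝ} (hk : Measurable k) (x : E) :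
    Measurable fun w : E × 𝒴 => labelledKernel y k w x :=
  (measurable_labelledKernel y hk).comp measurable_prodMk_right

theorem measurable_labelledKernel_right (y : 𝒴) {k : E → ℝ} (hk : Measurable k) (w : E × 𝒴) :
    Measurable fun x : E => labelledKernel y k w x :=
  (measurable_labelledKernel y hk).comp measurable_prodMk_left

end LabelledKernel

/-! ### Strong `L¹` consistency of kernel estimates -/

section Auxiliary

theorem exists_pos_mul_ofReal_lt {C ε : ℝ≥0∞} (hC : C ≠ ∞) (hε : ε ≠ 0) :
    ∃ δ : ℝ, 0 < δ ∧ C * ENNReal.ofReal δ < ε := by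
  have h : Tendsto (fun δ : ℝ => C * ENNReal.ofReal δ) (𝓝[>] 0) (𝓝 0) := by
    have h1 : Tendsto (fun δ : ℝ => ENNReal.ofReal δ) (𝓝[>] 0) (𝓝 0) := by
      simpa using (ENNReal.continuous_ofReal.tendsto 0).mono_left nhdsWithin_le_nhds
    simpa using ENNReal.Tendsto.const_mul h1 (Or.inr hC)
  obtain ⟨δ, h1, h2⟩ := ((h.eventually (gt_mem_nhds (pos_iff_ne_zero.2 hε))).and
    self_mem_nhdsWithin).exists
  exact ⟨δ, h2, h1⟩

theorem lintegral_lintegral_sub_mul {E : Type*} [NormedAddCommGroup E] [MeasurableSpace E]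
    [BorelSpace E] [SecondCountableTopology E] (μ : Measure E) [μ.IsAddLeftInvariant]
    [μ.IsNegInvariant] [SFinite μ] {φ ψ : E → ℝ≥0∞} (hφ : Measurable φ) (hψ : Measurable ψ) :
    ∫⁻ x, ∫⁻ t, φ (t - x) * ψ t ∂μ ∂μ = (∫⁻ u, φ u ∂μ) * ∫⁻ t, ψ t ∂μ := by
  rw [lintegral_lintegral_swap (by fun_prop)]
  have : ∀ t, ∫⁻ x, φ (t - x) * ψ t ∂μ = (∫⁻ u, φ u ∂μ) * ψ t := fun t => by
    rw [lintegral_mul_const _ (f := fun x => φ (t - x)) (hφ.comp (measurable_id.const_sub t)),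
      lintegral_sub_left_eq_self]
  simp only [this]
  rw [lintegral_const_mul _ hψ]

variable {X Ω : Type*} [MeasurableSpace X] [MeasurableSpace Ω] {μ : Measure X} {P : Measure Ω}
  [IsProbabilityMeasure P]

theorem lintegral_lintegral_add_add {φ ψ : X × Ω → ℝ≥0∞} (hφ : Measurable φ) (hψ : Measurable ψ)
    (χ : X → ℝ≥0∞) :
    ∫⁻ x, ∫⁻ ω, (φ (x, ω) + (ψ (x, ω) + χ x)) ∂P ∂μ
      = ∫⁻ x, ∫⁻ ω, φ (x, ω) ∂P ∂μ + (∫⁻ x, ∫⁻ ω, ψ (x, ω) ∂P ∂μ + ∫⁻ x, χ x ∂μ) := by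
  have h : ∀ x, ∫⁻ ω, (φ (x, ω) + (ψ (x, ω) + χ x)) ∂P
      = ∫⁻ ω, φ (x, ω) ∂P + (∫⁻ ω, ψ (x, ω) ∂P + χ x) := fun x => by
    rw [lintegral_add_left (f := fun ω => φ (x, ω)) (hφ.comp measurable_prodMk_left),
      lintegral_add_left (f := fun ω => ψ (x, ω)) (hψ.comp measurable_prodMk_left),
      lintegral_const, measure_univ, mul_one]
  simp only [h]
  rw [lintegral_add_left hφ.lintegral_prod_right', lintegral_add_left hψ.lintegral_prod_right']

variable [SFinite μ]

theorem tendsto_integral_integral_abs_of_lintegral {f : ℕ → X × Ω → ℝ}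
    (hf : ∀ n, Measurable (f n)) (hfi : ∀ n ω, Integrable (fun x => f n (x, ω)) μ)
    (hlim : Tendsto (fun n => ∫⁻ x, ∫⁻ ω, ‖f n (x, ω)‖ₑ ∂P ∂μ) atTop (𝓝 0)) :
    Tendsto (fun n => ∫ ω, ∫ x, |f n (x, ω)| ∂μ ∂P) atTop (𝓝 0) := by
  have h1 := (ENNReal.tendsto_toReal ENNReal.zero_ne_top).comp hlim
  rw [ENNReal.toReal_zero] at h1
  refine h1.congr fun n => ?_
  have hm : Measurable fun ω => ∫⁻ x, ‖f n (x, ω)‖ₑ ∂μ := (hf n).enorm.lintegral_prod_left'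
  rw [Function.comp_apply, lintegral_lintegral_swap (f := fun x ω => ‖f n (x, ω)‖ₑ)
    (hf n).enorm.aemeasurable, ← integral_toReal hm.aemeasurable (ae_of_all _ fun ω => (hfi n ω).2)]
  refine integral_congr_ae (ae_of_all _ fun ω => ?_)
  simp only [← Real.norm_eq_abs]
  rw [integral_norm_eq_lintegral_enorm (hfi n ω).aestronglyMeasurable]

end Auxiliary

section Consistency

variable {Ω : Type*} [MeasurableSpace Ω] {P : Measure Ω} [IsProbabilityMeasure P]
  {E : Type*} [NormedAddCommGroup E] [NormedSpace ℝ E] [FiniteDimensional ℝ E]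
  [MeasurableSpace E] [BorelSpace E] {μ : Measure E}
  {𝒴 : Type*} [DecidableEq 𝒴] [MeasurableSpace 𝒴] [MeasurableSingletonClass 𝒴]
  {Z : ℕ → Ω → E × 𝒴} {ν : Measure (E × 𝒴)} {y : 𝒴} {g : E → ℝ}

theorem measurable_mean_labelledKernel (hZ : ∀ i, Measurable (Z i)) {k : E → ℝ}
    (hk : Measurable k) (y : 𝒴) (n : ℕ) :
    Measurable fun p : E × Ω =>
      (1 / (n : ℝ)) * ∑ i ∈ Finset.range n, labelledKernel y k (Z i p.2) p.1 := by
  refine (Finset.measurable_fun_sum _ fun i _ => ?_).const_mul _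
  exact (measurable_labelledKernel y hk).comp (((hZ i).comp measurable_snd).prodMk measurable_fst)

/-- At a fixed point, the mean deviation of the smoothed empirical density from its expectation is
bounded through second moments and through first absolute moments. -/
theorem lintegral_enorm_mean_labelledKernel_sub_le (hZ : ∀ i, Measurable (Z i))
    (hind : iIndepFun Z P) (hν : ∀ i, P.map (Z i) = ν) (hd : IsLabelDensity ν μ y g)
    (hg : Measurable g) (hg0 : ∀ t, 0 ≤ g t) {k : E → ℝ} (hk : Measurable k) {M : ℝ}
    (hM : ∀ u, |k u| ≤ M) {n : ℕ} (hn : 0 < n) {s : ℝ} (hs : 0 < s) (x : E) :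
    ∫⁻ ω, ‖(1 / (n : ℝ)) * ∑ i ∈ Finset.range n, labelledKernel y k (Z i ω) x
        - ∫ t, k (t - x) * g t ∂μ‖ₑ ∂P
      ≤ ENNReal.ofReal s
        + ENNReal.ofReal (1 / (s * n)) * ∫⁻ t, ‖k (t - x)‖ₑ ^ 2 * ‖g t‖ₑ ∂μ ∧
    ∫⁻ ω, ‖(1 / (n : ℝ)) * ∑ i ∈ Finset.range n, labelledKernel y k (Z i ω) x
        - ∫ t, k (t - x) * g t ∂μ‖ₑ ∂P
      ≤ 2 * ENNReal.ofReal (∫ t, |k (t - x)| * g t ∂μ) := by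
  have hLm := measurable_labelledKernel_left (𝒴 := 𝒴) y hk x
  have hXm : ∀ i, Measurable fun ω => labelledKernel y k (Z i ω) x := fun i => hLm.comp (hZ i)
  have hXM : ∀ i ω, |labelledKernel y k (Z i ω) x| ≤ M := fun i ω =>
    (abs_labelledKernel_le y k _ x).trans (hM _)
  have hXi : ∀ i, Integrable (fun ω => labelledKernel y k (Z i ω) x) P := fun i =>
    Integrable.of_bound (hXm i).aestronglyMeasurable M (ae_of_all _ (hXM i))
  have hmean : ∀ i, ∫ ω, labelledKernel y k (Z i ω) x ∂P = ∫ t, k (t - x) * g t ∂μ := fun i => by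
    rw [← hd.integral_labelledKernel hg hg0 hk, ← hν i,
      integral_map (hZ i).aemeasurable hLm.aestronglyMeasurable]
  have habs : ∀ i, ∫ ω, |labelledKernel y k (Z i ω) x| ∂P = ∫ t, |k (t - x)| * g t ∂μ := fun i => by
    rw [← hd.integral_abs_labelledKernel hg hg0 hk, ← hν i,
      integral_map (hZ i).aemeasurable hLm.abs.aestronglyMeasurable]
  have hsq : ∀ i, ∫ ω, labelledKernel y k (Z i ω) x ^ 2 ∂P = ∫ t, k (t - x) ^ 2 * g t ∂μ :=
    fun i => by
      rw [← hd.integral_sq_labelledKernel hg hg0 hk, ← hν i,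
        integral_map (hZ i).aemeasurable (hLm.pow_const 2).aestronglyMeasurable]
  have hYi : Integrable (fun ω => (1 / (n : ℝ)) * ∑ i ∈ Finset.range n,
      labelledKernel y k (Z i ω) x - ∫ t, k (t - x) * g t ∂μ) P :=
    ((integrable_finsetSum _ fun i _ => hXi i).const_mul _).sub (integrable_const _)
  rw [← ofReal_integral_norm_eq_lintegral_enorm hYi]
  constructor
  · refine (ENNReal.ofReal_le_ofReal (integral_abs_sampleMean_sub_le hXm hXM
      (fun i j hij => (hind.indepFun hij).comp hLm hLm) hmean (fun i => (hsq i).le) hn hs)).trans ?_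
    have h0 : 0 ≤ ∫ t, k (t - x) ^ 2 * g t ∂μ :=
      integral_nonneg fun t => mul_nonneg (sq_nonneg _) (hg0 t)
    rw [ENNReal.ofReal_add hs.le (by positivity), ENNReal.ofReal_mul (by positivity)]
    gcongr
    rw [← Real.enorm_of_nonneg h0]
    refine (enorm_integral_le_lintegral_enorm _).trans (le_of_eq ?_)
    simp only [enorm_mul, enorm_pow]
  · refine (ENNReal.ofReal_le_ofReal (integral_abs_sampleMean_sub_le_two_mul hXi hmean
      (fun i => (habs i).le) hn)).trans (le_of_eq ?_)
    rw [ENNReal.ofReal_mul (by norm_num)]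
    simp

variable [μ.IsAddHaarMeasure]

/-- The variance term: for a bounded kernel, the `L¹` distance of the smoothed empirical density from
its expectation tends to zero in mean. -/
theorem tendsto_lintegral_mean_sub_smoothing (hZ : ∀ i, Measurable (Z i)) (hind : iIndepFun Z P)
    (hν : ∀ i, P.map (Z i) = ν) (hd : IsLabelDensity ν μ y g) (hg : Measurable g)
    (hg0 : ∀ t, 0 ≤ g t) (hgi : Integrable g μ) {K : E → ℝ} (hK : Measurable K)
    (hKi : Integrable K μ) {M : ℝ} (hM : ∀ u, |K u| ≤ M) {h : ℕ → ℝ} (hpos : ∀ n, 0 < h n)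
    (hlim : Tendsto h atTop (𝓝 0))
    (hrate : Tendsto (fun n : ℕ => (n : ℝ) * h n ^ Module.finrank ℝ E) atTop atTop) :
    Tendsto (fun n : ℕ => ∫⁻ x, ∫⁻ ω, ‖(1 / (n : ℝ)) * ∑ i ∈ Finset.range n,
        labelledKernel y (scaledKernel K (h n)) (Z i ω) x
        - ∫ t, scaledKernel K (h n) (t - x) * g t ∂μ‖ₑ ∂P ∂μ) atTop (𝓝 0) := by
  set D := Module.finrank ℝ E with hD
  set κ : ℝ := ∫ u, |K u| ∂μ with hκ
  set Q : ℝ≥0∞ := (∫⁻ u, ‖K u‖ₑ ^ 2 ∂μ) * ∫⁻ t, ‖g t‖ₑ ∂μ with hQ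
  have hQtop : Q ≠ ∞ := by
    refine ENNReal.mul_ne_top (ne_top_of_le_ne_top (ENNReal.mul_ne_top
      (ENNReal.ofReal_ne_top (r := M)) hKi.2.ne) (b := ENNReal.ofReal M * ∫⁻ u, ‖K u‖ₑ ∂μ) ?_)
      hgi.2.ne
    rw [← lintegral_const_mul _ hK.enorm]
    refine lintegral_mono fun u => ?_
    rw [pow_two]
    gcongr
    rw [← ofReal_norm]
    exact ENNReal.ofReal_le_ofReal (hM u)
  set b : ℕ → ℝ≥0∞ := fun n => ∫⁻ x, ‖∫ t, scaledKernel (fun u => |K u|) (h n) (t - x) * g t ∂μ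
    - κ * g x‖ₑ ∂μ with hb
  have hbias : Tendsto b atTop (𝓝 0) :=
    tendsto_lintegral_enorm_smoothing_sub μ hK.abs hKi.abs (M := M) (by simpa using hM) hg hgi
      hpos hlim
  -- the integral over a set of finite measure is bounded through the variance, the integral over
  -- its complement through the first absolute moment
  have hmain : ∀ (B : Set E), MeasurableSet B → ∀ (s : ℝ), 0 < s → ∀ n : ℕ, 0 < n →
      ∫⁻ x, ∫⁻ ω, ‖(1 / (n : ℝ)) * ∑ i ∈ Finset.range n,
        labelledKernel y (scaledKernel K (h n)) (Z i ω) x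
        - ∫ t, scaledKernel K (h n) (t - x) * g t ∂μ‖ₑ ∂P ∂μ
      ≤ (μ B * ENNReal.ofReal s + ENNReal.ofReal (1 / s * (n * h n ^ D)⁻¹) * Q)
        + (2 * b n + 2 * ‖κ‖ₑ * ∫⁻ x in Bᶜ, ‖g x‖ₑ ∂μ) := by
    intro B hB s hs n hn
    have hkm := measurable_scaledKernel hK (h n)
    have hkM : ∀ u, |scaledKernel K (h n) u| ≤ 1 / h n ^ D * M := fun u => by
      have := hpos n
      rw [scaledKernel, abs_mul, abs_of_nonneg (by positivity)]
      gcongr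
      exact hM _
    have hx := lintegral_enorm_mean_labelledKernel_sub_le hZ hind hν hd hg hg0 hkm hkM hn hs
    rw [← lintegral_add_compl _ hB]
    refine add_le_add ?_ ?_
    · refine (lintegral_mono fun x => (hx x).1).trans ?_
      have hm : Measurable fun x => ∫⁻ t, ‖scaledKernel K (h n) (t - x)‖ₑ ^ 2 * ‖g t‖ₑ ∂μ := by
        have : Measurable fun p : E × E => ‖scaledKernel K (h n) (p.2 - p.1)‖ₑ ^ 2 * ‖g p.2‖ₑ :=
          ((hkm.comp (measurable_snd.sub measurable_fst)).enorm.pow_const 2).mul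
            (hg.comp measurable_snd).enorm
        exact this.lintegral_prod_right'
      rw [lintegral_add_left measurable_const, lintegral_const_mul _ hm]
      refine add_le_add ?_ ?_
      · rw [setLIntegral_const, mul_comm]
      · calc ENNReal.ofReal (1 / (s * n)) * ∫⁻ x in B, ∫⁻ t,
              ‖scaledKernel K (h n) (t - x)‖ₑ ^ 2 * ‖g t‖ₑ ∂μ ∂μ
            ≤ ENNReal.ofReal (1 / (s * n)) * ∫⁻ x, ∫⁻ t,
              ‖scaledKernel K (h n) (t - x)‖ₑ ^ 2 * ‖g t‖ₑ ∂μ ∂μ := by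
              gcongr
              exact Measure.restrict_le_self
          _ = ENNReal.ofReal (1 / s * (n * h n ^ D)⁻¹) * Q := by
              have := hpos n
              rw [lintegral_lintegral_sub_mul μ (φ := fun u => ‖scaledKernel K (h n) u‖ₑ ^ 2)
                (hkm.enorm.pow_const 2) hg.enorm, lintegral_enorm_sq_scaledKernel μ K this, hQ,
                mul_assoc, ← mul_assoc (ENNReal.ofReal _), ← ENNReal.ofReal_mul (by positivity)]
              congr 2
              rw [← hD]
              field_simp
    · calc _ ≤ ∫⁻ x in Bᶜ, 2 * (‖∫ t, scaledKernel (fun u => |K u|) (h n) (t - x) * g t ∂μ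
              - κ * g x‖ₑ + ‖κ‖ₑ * ‖g x‖ₑ) ∂μ := by
            refine lintegral_mono fun x => (hx x).2.trans ?_
            gcongr
            simp only [abs_scaledKernel K (hpos n)]
            refine (Real.ofReal_le_enorm _).trans ?_
            rw [← enorm_mul]
            refine le_trans (le_of_eq ?_) (enorm_add_le _ _)
            rw [sub_add_cancel]
        _ ≤ 2 * b n + 2 * ‖κ‖ₑ * ∫⁻ x in Bᶜ, ‖g x‖ₑ ∂μ := by
            rw [lintegral_const_mul' _ _ (by simp), lintegral_add_right _ (hg.enorm.const_mul _),
              lintegral_const_mul _ hg.enorm, mul_add, mul_assoc]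
            gcongr
            exact setLIntegral_le_lintegral _ _
  rw [ENNReal.tendsto_nhds_zero]
  intro ε hε
  have hε2 : ε / 2 ≠ 0 := (ENNReal.half_pos hε.ne').ne'
  obtain ⟨δ, hδ, hδε⟩ := exists_pos_mul_ofReal_lt (C := 2 * ‖κ‖ₑ)
    (ENNReal.mul_ne_top (by simp) enorm_ne_top) hε2
  obtain ⟨B, hB, hBfin, hBδ⟩ := exists_setLIntegral_compl_lt (μ := μ) hgi.2.ne
    (ENNReal.ofReal_pos.2 hδ).ne'
  obtain ⟨s, hs, hsε⟩ := exists_pos_mul_ofReal_lt hBfin.ne hε2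
  have hlimU : Tendsto (fun n : ℕ =>
      (μ B * ENNReal.ofReal s + ENNReal.ofReal (1 / s * (n * h n ^ D)⁻¹) * Q)
        + (2 * b n + 2 * ‖κ‖ₑ * ∫⁻ x in Bᶜ, ‖g x‖ₑ ∂μ)) atTop
      (𝓝 ((μ B * ENNReal.ofReal s + ENNReal.ofReal (1 / s * 0) * Q)
        + (2 * 0 + 2 * ‖κ‖ₑ * ∫⁻ x in Bᶜ, ‖g x‖ₑ ∂μ))) := by
    refine (tendsto_const_nhds.add (ENNReal.Tendsto.mul_const ?_ (Or.inr hQtop))).add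
      ((ENNReal.Tendsto.const_mul hbias (Or.inr (by simp))).add tendsto_const_nhds)
    exact (ENNReal.continuous_ofReal.tendsto _).comp (hrate.inv_tendsto_atTop.const_mul _)
  have hlt : (μ B * ENNReal.ofReal s + ENNReal.ofReal (1 / s * 0) * Q)
        + (2 * 0 + 2 * ‖κ‖ₑ * ∫⁻ x in Bᶜ, ‖g x‖ₑ ∂μ) < ε := by
    rw [← ENNReal.add_halves ε]
    simp only [mul_zero, ENNReal.ofReal_zero, zero_mul, add_zero, zero_add]
    exact ENNReal.add_lt_add hsε ((mul_le_mul_right hBδ.le _).trans_lt hδε)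
  filter_upwards [hlimU.eventually (gt_mem_nhds hlt), eventually_gt_atTop 0] with n hn hn0
  exact (hmain B hB s hs n hn0).trans hn.le

/-- A sample mean of labelled kernels has `L¹` norm at most that of the kernel, for every sample. -/
theorem lintegral_enorm_mean_labelledKernel_le {ι : Type*} (s : Finset ι) (y : 𝒴) {k : E → ℝ}
    (hk : Measurable k) (z : ι → E × 𝒴) :
    ∫⁻ x, ‖(1 / (s.card : ℝ)) * ∑ i ∈ s, labelledKernel y k (z i) x‖ₑ ∂μ ≤ ∫⁻ u, ‖k u‖ₑ ∂μ := by
  rcases s.eq_empty_or_nonempty with rfl | hs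
  · simp
  have hc : (s.card : ℝ≥0∞) ≠ 0 := by simpa using hs.ne_empty
  have h1 : ‖(1 / (s.card : ℝ))‖ₑ = (s.card : ℝ≥0∞)⁻¹ := by
    rw [one_div, enorm_inv (by simpa using hs.ne_empty)]
    simp
  calc ∫⁻ x, ‖(1 / (s.card : ℝ)) * ∑ i ∈ s, labelledKernel y k (z i) x‖ₑ ∂μ
      ≤ ∫⁻ x, (s.card : ℝ≥0∞)⁻¹ * ∑ i ∈ s, ‖labelledKernel y k (z i) x‖ₑ ∂μ := by
        refine lintegral_mono fun x => ?_
        rw [enorm_mul, h1]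
        gcongr
        exact enorm_sum_le _ _
    _ = (s.card : ℝ≥0∞)⁻¹ * ∑ i ∈ s, ∫⁻ x, ‖labelledKernel y k (z i) x‖ₑ ∂μ := by
        have hm : ∀ i, Measurable fun x => ‖labelledKernel y k (z i) x‖ₑ := fun i =>
          (measurable_labelledKernel_right y hk (z i)).enorm
        rw [lintegral_const_mul _ (Finset.measurable_fun_sum _ fun i _ => hm i),
          lintegral_finsetSum _ fun i _ => hm i]
    _ ≤ (s.card : ℝ≥0∞)⁻¹ * (s.card * ∫⁻ u, ‖k u‖ₑ ∂μ) := by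
        gcongr
        refine (Finset.sum_le_sum fun i _ => lintegral_enorm_labelledKernel_le μ y k (z i)).trans
          (le_of_eq ?_)
        simp
    _ = ∫⁻ u, ‖k u‖ₑ ∂μ := by
        rw [← mul_assoc, ENNReal.inv_mul_cancel hc (by simp), one_mul]

theorem tendsto_lintegral_mean_sub_density_of_bounded (hZ : ∀ i, Measurable (Z i))
    (hind : iIndepFun Z P) (hν : ∀ i, P.map (Z i) = ν) (hd : IsLabelDensity ν μ y g)
    (hg : Measurable g) (hg0 : ∀ t, 0 ≤ g t) (hgi : Integrable g μ) {K : E → ℝ}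
    (hK : Measurable K) (hKi : Integrable K μ) {M : ℝ} (hM : ∀ u, |K u| ≤ M) {h : ℕ → ℝ}
    (hpos : ∀ n, 0 < h n) (hlim : Tendsto h atTop (𝓝 0))
    (hrate : Tendsto (fun n : ℕ => (n : ℝ) * h n ^ Module.finrank ℝ E) atTop atTop) :
    Tendsto (fun n : ℕ => ∫⁻ x, ∫⁻ ω, ‖(1 / (n : ℝ)) * ∑ i ∈ Finset.range n,
        labelledKernel y (scaledKernel K (h n)) (Z i ω) x - (∫ u, K u ∂μ) * g x‖ₑ ∂P ∂μ)
      atTop (𝓝 0) := by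
  have hvar := tendsto_lintegral_mean_sub_smoothing hZ hind hν hd hg hg0 hgi hK hKi hM hpos hlim
    hrate
  have hbias := tendsto_lintegral_enorm_smoothing_sub μ hK hKi hM hg hgi hpos hlim
  have hadd := hvar.add hbias
  rw [add_zero] at hadd
  refine tendsto_of_tendsto_of_tendsto_of_le_of_le tendsto_const_nhds hadd (fun _ => zero_le)
    fun n => ?_
  have hl : Measurable fun x => ∫ t, scaledKernel K (h n) (t - x) * g t ∂μ := by
    have : Measurable fun p : E × E => scaledKernel K (h n) (p.2 - p.1) * g p.2 :=
      ((measurable_scaledKernel hK (h n)).comp (measurable_snd.sub measurable_fst)).mul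
        (hg.comp measurable_snd)
    exact (this.stronglyMeasurable.integral_prod_right' (ν := μ)).measurable
  have hm : Measurable fun x => ‖∫ t, scaledKernel K (h n) (t - x) * g t ∂μ
      - (∫ u, K u ∂μ) * g x‖ₑ := (hl.sub (hg.const_mul _)).enorm
  simp only
  rw [← lintegral_add_right _ hm]
  refine lintegral_mono fun x => ?_
  simp only
  set l := ∫ t, scaledKernel K (h n) (t - x) * g t ∂μ
  calc ∫⁻ ω, ‖(1 / (n : ℝ)) * ∑ i ∈ Finset.range n,
        labelledKernel y (scaledKernel K (h n)) (Z i ω) x - (∫ u, K u ∂μ) * g x‖ₑ ∂P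
      ≤ ∫⁻ ω, (‖(1 / (n : ℝ)) * ∑ i ∈ Finset.range n,
        labelledKernel y (scaledKernel K (h n)) (Z i ω) x - l‖ₑ
        + ‖l - (∫ u, K u ∂μ) * g x‖ₑ) ∂P := by
        refine lintegral_mono fun ω => ?_
        refine le_trans (le_of_eq ?_) (enorm_add_le _ _)
        rw [sub_add_sub_cancel]
    _ = _ := by
        rw [lintegral_add_right _ measurable_const, lintegral_const, measure_univ, mul_one]

/-- Consistency in mean for an integrable kernel. It is split into a bounded kernel and a remainder
of small `L¹` norm; the remainder contributes at most its norm, once through the sample and once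
through its integral. -/
theorem tendsto_lintegral_mean_sub_density (hZ : ∀ i, Measurable (Z i))
    (hind : iIndepFun Z P) (hν : ∀ i, P.map (Z i) = ν) (hd : IsLabelDensity ν μ y g)
    (hg : Measurable g) (hg0 : ∀ t, 0 ≤ g t) (hgi : Integrable g μ) {K : E → ℝ}
    (hK : Measurable K) (hKi : Integrable K μ) {h : ℕ → ℝ}
    (hpos : ∀ n, 0 < h n) (hlim : Tendsto h atTop (𝓝 0))
    (hrate : Tendsto (fun n : ℕ => (n : ℝ) * h n ^ Module.finrank ℝ E) atTop atTop) :
    Tendsto (fun n : ℕ => ∫⁻ x, ∫⁻ ω, ‖(1 / (n : ℝ)) * ∑ i ∈ Finset.range n,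
        labelledKernel y (scaledKernel K (h n)) (Z i ω) x - (∫ u, K u ∂μ) * g x‖ₑ ∂P ∂μ)
      atTop (𝓝 0) := by
  rw [ENNReal.tendsto_nhds_zero]
  intro ε hε
  have hε2 : ε / 2 ≠ 0 := (ENNReal.half_pos hε.ne').ne'
  have hgtop : (1 + ∫⁻ t, ‖g t‖ₑ ∂μ) ≠ ∞ := ENNReal.add_ne_top.2 ⟨by simp, hgi.2.ne⟩
  obtain ⟨δ, hδ, hδε⟩ := exists_pos_mul_ofReal_lt hgtop hε2
  obtain ⟨K', hKK', hK'i⟩ := hKi.exists_boundedContinuous_lintegral_sub_le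
    (ENNReal.ofReal_pos.2 hδ).ne'
  have hK'm : Measurable K' := K'.continuous.measurable
  set R : E → ℝ := fun u => K u - K' u with hR
  have hRm : Measurable R := hK.sub hK'm
  have hlim' := tendsto_lintegral_mean_sub_density_of_bounded hZ hind hν hd hg hg0 hgi hK'm hK'i
    (M := ‖K'‖) (fun u => K'.norm_coe_le_norm u) hpos hlim hrate
  filter_upwards [ENNReal.tendsto_nhds_zero.1 hlim' (ε / 2) (pos_iff_ne_zero.2 hε2)] with n hn
  rw [← ENNReal.add_halves ε]
  refine le_trans ?_ (add_le_add hn hδε.le)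
  have hsub : ∀ x ω, (1 / (n : ℝ)) * ∑ i ∈ Finset.range n,
        labelledKernel y (scaledKernel K (h n)) (Z i ω) x - (∫ u, K u ∂μ) * g x
      = ((1 / (n : ℝ)) * ∑ i ∈ Finset.range n,
        labelledKernel y (scaledKernel K' (h n)) (Z i ω) x - (∫ u, K' u ∂μ) * g x)
        + ((1 / (n : ℝ)) * ∑ i ∈ Finset.range n,
          labelledKernel y (scaledKernel R (h n)) (Z i ω) x - (∫ u, R u ∂μ) * g x) := by
    intro x ω
    have h1 : ∑ i ∈ Finset.range n, labelledKernel y (scaledKernel R (h n)) (Z i ω) x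
        = ∑ i ∈ Finset.range n, labelledKernel y (scaledKernel K (h n)) (Z i ω) x
          - ∑ i ∈ Finset.range n, labelledKernel y (scaledKernel K' (h n)) (Z i ω) x := by
      rw [← Finset.sum_sub_distrib]
      refine Finset.sum_congr rfl fun i _ => ?_
      simp only [labelledKernel, scaledKernel, hR]
      ring
    rw [h1, hR, integral_sub hKi hK'i]
    ring
  have hmR : Measurable fun p : E × Ω => ‖(1 / (n : ℝ)) * ∑ i ∈ Finset.range n,
      labelledKernel y (scaledKernel R (h n)) (Z i p.2) p.1‖ₑ :=
    (measurable_mean_labelledKernel hZ (measurable_scaledKernel hRm (h n)) y n).enorm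
  have hmK' : Measurable fun p : E × Ω => ‖(1 / (n : ℝ)) * ∑ i ∈ Finset.range n,
      labelledKernel y (scaledKernel K' (h n)) (Z i p.2) p.1 - (∫ u, K' u ∂μ) * g p.1‖ₑ :=
    ((measurable_mean_labelledKernel hZ (measurable_scaledKernel hK'm (h n)) y n).sub
      ((hg.comp measurable_fst).const_mul _)).enorm
  calc ∫⁻ x, ∫⁻ ω, ‖(1 / (n : ℝ)) * ∑ i ∈ Finset.range n,
        labelledKernel y (scaledKernel K (h n)) (Z i ω) x - (∫ u, K u ∂μ) * g x‖ₑ ∂P ∂μ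
      ≤ ∫⁻ x, ∫⁻ ω, (‖(1 / (n : ℝ)) * ∑ i ∈ Finset.range n,
        labelledKernel y (scaledKernel K' (h n)) (Z i ω) x - (∫ u, K' u ∂μ) * g x‖ₑ
        + (‖(1 / (n : ℝ)) * ∑ i ∈ Finset.range n,
          labelledKernel y (scaledKernel R (h n)) (Z i ω) x‖ₑ + ‖∫ u, R u ∂μ‖ₑ * ‖g x‖ₑ)) ∂P ∂μ := by
        refine lintegral_mono fun x => lintegral_mono fun ω => ?_
        rw [hsub, ← enorm_mul]
        exact (enorm_add_le _ _).trans (add_le_add_right enorm_sub_le _)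
    _ = ∫⁻ x, ∫⁻ ω, ‖(1 / (n : ℝ)) * ∑ i ∈ Finset.range n,
        labelledKernel y (scaledKernel K' (h n)) (Z i ω) x - (∫ u, K' u ∂μ) * g x‖ₑ ∂P ∂μ
        + (∫⁻ x, ∫⁻ ω, ‖(1 / (n : ℝ)) * ∑ i ∈ Finset.range n,
          labelledKernel y (scaledKernel R (h n)) (Z i ω) x‖ₑ ∂P ∂μ
          + ‖∫ u, R u ∂μ‖ₑ * ∫⁻ t, ‖g t‖ₑ ∂μ) := by
        rw [← lintegral_const_mul _ hg.enorm]
        exact lintegral_lintegral_add_add hmK' hmR _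
    _ ≤ _ := by
        refine add_le_add_right ?_ _
        have hRδ : ‖∫ u, R u ∂μ‖ₑ ≤ ENNReal.ofReal δ :=
          (enorm_integral_le_lintegral_enorm _).trans hKK'
        rw [add_mul, one_mul, mul_comm (∫⁻ t, ‖g t‖ₑ ∂μ)]
        refine add_le_add ?_ (mul_le_mul_left hRδ _)
        rw [lintegral_lintegral_swap hmR.aemeasurable]
        calc _ ≤ ∫⁻ _ω, ENNReal.ofReal δ ∂P := by
              refine lintegral_mono fun ω => ?_
              have := lintegral_enorm_mean_labelledKernel_le (μ := μ) (Finset.range n) y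
                (measurable_scaledKernel hRm (h n)) (fun i => Z i ω)
              rw [Finset.card_range, lintegral_enorm_scaledKernel μ R (hpos n)] at this
              exact this.trans hKK'
          _ = ENNReal.ofReal δ := by simp

/-- Strong `L¹` consistency of the kernel estimate of the density of the covariates with label `y`. -/
theorem ae_tendsto_integral_abs_mean_sub_density (hZ : ∀ i, Measurable (Z i))
    (hind : iIndepFun Z P) (hν : ∀ i, P.map (Z i) = ν) (hd : IsLabelDensity ν μ y g)
    (hg : Measurable g) (hg0 : ∀ t, 0 ≤ g t) (hgi : Integrable g μ) {K : E → ℝ}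
    (hK : Measurable K) (hKi : Integrable K μ) (hK1 : ∫ u, K u ∂μ = 1) {h : ℕ → ℝ}
    (hpos : ∀ n, 0 < h n) (hlim : Tendsto h atTop (𝓝 0))
    (hrate : Tendsto (fun n : ℕ => (n : ℝ) * h n ^ Module.finrank ℝ E) atTop atTop) :
    ∀ᵐ ω ∂P, Tendsto (fun n : ℕ => ∫ x, |(1 / (n : ℝ)) * ∑ i ∈ Finset.range n,
        labelledKernel y (scaledKernel K (h n)) (Z i ω) x - g x| ∂μ) atTop (𝓝 0) := by
  have : IsProbabilityMeasure ν := by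
    rw [← hν 0]
    exact Measure.isProbabilityMeasure_map (hZ 0).aemeasurable
  have hlimE := tendsto_lintegral_mean_sub_density hZ hind hν hd hg hg0 hgi hK hKi hpos hlim hrate
  simp only [hK1, one_mul] at hlimE
  set F : ∀ n : ℕ, (Fin n → E × 𝒴) → ℝ := fun n z => ∫ x, |(1 / (n : ℝ)) * ∑ i,
    labelledKernel y (scaledKernel K (h n)) (z i) x - g x| ∂μ with hF
  have hki : ∀ n, Integrable (scaledKernel K (h n)) μ := fun n =>
    integrable_scaledKernel μ hK hKi (hpos n)
  have hkm : ∀ n, Measurable (scaledKernel K (h n)) := fun n => measurable_scaledKernel hK (h n)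
  have hnorm : ∀ n, ∫ u, |scaledKernel K (h n) u| ∂μ = ∫ u, |K u| ∂μ := fun n => by
    simp only [← Real.norm_eq_abs]
    rw [integral_norm_eq_lintegral_enorm (hkm n).aestronglyMeasurable,
      integral_norm_eq_lintegral_enorm hK.aestronglyMeasurable,
      lintegral_enorm_scaledKernel μ K (hpos n)]
  have hsi : ∀ n (z : Fin n → E × 𝒴), Integrable (fun x => (1 / (n : ℝ)) * ∑ i,
      labelledKernel y (scaledKernel K (h n)) (z i) x) μ := fun n z =>
    (integrable_finsetSum _ fun i _ => integrable_labelledKernel_right y (hki n) (z i)).const_mul _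
  have hFrange : ∀ n ω, F n (fun i => Z i ω) = ∫ x, |(1 / (n : ℝ)) * ∑ i ∈ Finset.range n,
      labelledKernel y (scaledKernel K (h n)) (Z i ω) x - g x| ∂μ := fun n ω => by
    simp only [hF, Finset.sum_range]
  have hFm : ∀ n, Measurable (F n) := fun n => by
    have h1 : Measurable fun p : (Fin n → E × 𝒴) × E => |(1 / (n : ℝ)) * ∑ i,
        labelledKernel y (scaledKernel K (h n)) (p.1 i) p.2 - g p.2| := by
      refine (((Finset.measurable_fun_sum _ fun i _ => ?_).const_mul _).sub
        (hg.comp measurable_snd)).abs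
      have h2 : Measurable fun p : (Fin n → E × 𝒴) × E => (p.1 i, p.2) :=
        ((measurable_pi_apply i).comp measurable_fst).prodMk measurable_snd
      exact (measurable_labelledKernel y (hkm n)).comp h2
    exact (h1.stronglyMeasurable.integral_prod_right' (ν := μ)).measurable
  have hF0 : ∀ n z, 0 ≤ F n z := fun n z => integral_nonneg fun x => abs_nonneg _
  have hFB : ∀ n z, F n z ≤ (∫ u, |K u| ∂μ) + ∫ x, |g x| ∂μ := fun n z => by
    calc F n z ≤ ∫ x, (|(1 / (n : ℝ)) * ∑ i, labelledKernel y (scaledKernel K (h n)) (z i) x|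
          + |g x|) ∂μ :=
          integral_mono ((hsi n z).sub hgi).abs ((hsi n z).abs.add hgi.abs) fun x => abs_sub _ _
      _ = ∫ x, |(1 / (n : ℝ)) * ∑ i, labelledKernel y (scaledKernel K (h n)) (z i) x| ∂μ
          + ∫ x, |g x| ∂μ := integral_add (hsi n z).abs hgi.abs
      _ ≤ _ := by
          refine add_le_add_left ?_ _
          have := lintegral_enorm_mean_labelledKernel_le (μ := μ) Finset.univ y (hkm n) z
          rw [Finset.card_univ, Fintype.card_fin, lintegral_enorm_scaledKernel μ K (hpos n)] at this
          simp only [← Real.norm_eq_abs]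
          rw [integral_norm_eq_lintegral_enorm (hsi n z).aestronglyMeasurable,
            integral_norm_eq_lintegral_enorm hK.aestronglyMeasurable]
          exact ENNReal.toReal_mono hKi.2.ne this
  have hFd : ∀ n z i a, |F n (Function.update z i a) - F n z|
      ≤ (2 * (∫ u, |K u| ∂μ) + 1) / n := fun n z i a => by
    have hdiff : ∀ x, ∑ j, labelledKernel y (scaledKernel K (h n)) (Function.update z i a j) x
        - ∑ j, labelledKernel y (scaledKernel K (h n)) (z j) x
        = labelledKernel y (scaledKernel K (h n)) a x
          - labelledKernel y (scaledKernel K (h n)) (z i) x := fun x => by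
      rw [← Finset.sum_sub_distrib, Finset.sum_eq_single i]
      · simp
      · intro j _ hj
        simp [Function.update_of_ne hj]
      · simp
    have hA := integrable_labelledKernel_right y (hki n) a
    have hB := integrable_labelledKernel_right y (hki n) (z i)
    calc |F n (Function.update z i a) - F n z|
        ≤ ∫ x, |1 / (n : ℝ)| * (|labelledKernel y (scaledKernel K (h n)) a x|
          + |labelledKernel y (scaledKernel K (h n)) (z i) x|) ∂μ := by
          have hi : ∀ z' : Fin n → E × 𝒴, Integrable (fun x => |(1 / (n : ℝ)) * ∑ i,
              labelledKernel y (scaledKernel K (h n)) (z' i) x - g x|) μ :=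
            fun z' => ((hsi n z').sub hgi).abs
          rw [hF]
          simp only
          rw [← integral_sub (hi _) (hi _)]
          refine abs_integral_le_integral_abs.trans (integral_mono ((hi _).sub (hi _)).abs
            ((hA.abs.add hB.abs).const_mul _) fun x => ?_)
          refine (abs_abs_sub_abs_le_abs_sub _ _).trans ?_
          rw [sub_sub_sub_cancel_right, ← mul_sub, hdiff, abs_mul]
          gcongr
          exact abs_sub _ _
      _ = |1 / (n : ℝ)| * (∫ x, |labelledKernel y (scaledKernel K (h n)) a x| ∂μ
          + ∫ x, |labelledKernel y (scaledKernel K (h n)) (z i) x| ∂μ) := by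
          rw [integral_const_mul, integral_add hA.abs hB.abs]
      _ ≤ |1 / (n : ℝ)| * (∫ u, |K u| ∂μ + ∫ u, |K u| ∂μ) := by
          rw [← hnorm n]
          exact mul_le_mul_of_nonneg_left (add_le_add (integral_abs_labelledKernel_le y (hki n) a)
            (integral_abs_labelledKernel_le y (hki n) (z i))) (abs_nonneg _)
      _ ≤ (2 * (∫ u, |K u| ∂μ) + 1) / n := by
          rw [abs_of_nonneg (by positivity), ← two_mul, one_div_mul_eq_div]
          gcongr
          linarith
  have hFlim : Tendsto (fun n => ∫ ω, F n (fun i => Z i ω) ∂P) atTop (𝓝 0) := by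
    have h1 := tendsto_integral_integral_abs_of_lintegral (μ := μ) (P := P)
      (f := fun n p => (1 / (n : ℝ)) * ∑ i ∈ Finset.range n,
        labelledKernel y (scaledKernel K (h n)) (Z i p.2) p.1 - g p.1)
      (fun n => (measurable_mean_labelledKernel hZ (hkm n) y n).sub (hg.comp measurable_fst))
      (fun n ω => by
        simp only [Finset.sum_range]
        exact (hsi n fun i => Z i ω).sub hgi) hlimE
    simpa only [hFrange] using h1
  have hfin := ae_tendsto_zero_of_bounded_differences hZ hind hν hFm hF0 hFB
    -- one is added so that the constant is visibly positive
    (C := 2 * (∫ u, |K u| ∂μ) + 1) (by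
      have : 0 ≤ ∫ u, |K u| ∂μ := integral_nonneg fun _ => abs_nonneg _
      linarith) hFd hFlim
  filter_upwards [hfin] with ω hω
  simpa only [hFrange] using hω

end Consistency

/-! ### Stability of the total variation functional -/

section Stability

variable {𝒳 𝒴 : Type*} [Fintype 𝒴]

theorem abs_sum_abs_sub_mul_sum_sub_le {f : 𝒴 → ℝ} (hf : f ∈ stdSimplex ℝ 𝒴) (p p' : 𝒴 → ℝ) :
    |(∑ y, |p y - f y * ∑ y', p y'|) - (∑ y, |p' y - f y * ∑ y', p' y'|)|
      ≤ 2 * ∑ y, |p y - p' y| := by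
  rw [← Finset.sum_sub_distrib]
  calc |∑ y, (|p y - f y * ∑ y', p y'| - |p' y - f y * ∑ y', p' y'|)|
      ≤ ∑ y, (|p y - p' y| + f y * ∑ y', |p y' - p' y'|) := by
        refine (Finset.abs_sum_le_sum_abs _ _).trans (Finset.sum_le_sum fun y _ => ?_)
        refine (abs_abs_sub_abs_le_abs_sub _ _).trans ?_
        rw [show p y - f y * ∑ y', p y' - (p' y - f y * ∑ y', p' y')
          = (p y - p' y) - f y * ∑ y', (p y' - p' y') by rw [Finset.sum_sub_distrib]; ring]
        refine (abs_sub _ _).trans (add_le_add_right ?_ _)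
        rw [abs_mul, abs_of_nonneg (hf.1 y)]
        exact mul_le_mul_of_nonneg_left (Finset.abs_sum_le_sum_abs _ _) (hf.1 y)
    _ = 2 * ∑ y, |p y - p' y| := by
        rw [Finset.sum_add_distrib, ← Finset.sum_mul, hf.2]
        ring

variable [MeasurableSpace 𝒳] {μ : Measure 𝒳}

theorem integrable_joint {f : 𝒳 → 𝒴 → ℝ}
    (hfm : ∀ y, AEStronglyMeasurable (fun x => f x y) μ) (hf : ∀ᵐ x ∂μ, f x ∈ stdSimplex ℝ 𝒴)
    {m : 𝒳 → ℝ} (hm : Integrable m μ) (y : 𝒴) : Integrable (fun x => joint f m (x, y)) μ := by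
  refine hm.bdd_mul (c := 1) (hfm y) (hf.mono fun x hx => ?_)
  rw [Real.norm_eq_abs, abs_of_nonneg (hx.1 y), ← hx.2]
  exact Finset.single_le_sum (fun i _ => hx.1 i) (Finset.mem_univ y)

/-- The distance of a joint function from its own marginal times `f` is 1-Lipschitz in `L¹`. -/
theorem abs_tvd_joint_marginal_sub_le {f : 𝒳 → 𝒴 → ℝ}
    (hfm : ∀ y, AEStronglyMeasurable (fun x => f x y) μ) (hf : ∀ᵐ x ∂μ, f x ∈ stdSimplex ℝ 𝒴)
    {p p' : 𝒳 × 𝒴 → ℝ} (hp : ∀ y, Integrable (fun x => p (x, y)) μ)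
    (hp' : ∀ y, Integrable (fun x => p' (x, y)) μ) {m m' : 𝒳 → ℝ}
    (hm : ∀ᵐ x ∂μ, ∑ y, p (x, y) = m x) (hm' : ∀ᵐ x ∂μ, ∑ y, p' (x, y) = m' x) :
    |1 / 2 * ∫ x, ∑ y, |p (x, y) - joint f m (x, y)| ∂μ
      - 1 / 2 * ∫ x, ∑ y, |p' (x, y) - joint f m' (x, y)| ∂μ|
    ≤ ∑ y, ∫ x, |p (x, y) - p' (x, y)| ∂μ := by
  have hD : ∀ (r : 𝒳 × 𝒴 → ℝ) (k : 𝒳 → ℝ), (∀ y, Integrable (fun x => r (x, y)) μ) →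
      (∀ᵐ x ∂μ, ∑ y, r (x, y) = k x) →
      Integrable (fun x => ∑ y, |r (x, y) - joint f k (x, y)|) μ := fun r k hr hk =>
    integrable_finsetSum _ fun y _ => ((hr y).sub (integrable_joint hfm hf
      ((integrable_finsetSum _ fun y _ => hr y).congr hk) y)).abs
  have hpp' : ∀ y, Integrable (fun x => |p (x, y) - p' (x, y)|) μ := fun y =>
    ((hp y).sub (hp' y)).abs
  have hi : Integrable (fun x => ∑ y, |p (x, y) - p' (x, y)|) μ :=
    integrable_finsetSum _ fun y _ => hpp' y
  rw [← mul_sub, ← integral_sub (hD p m hp hm) (hD p' m' hp' hm'), abs_mul,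
    ← integral_finsetSum _ fun y _ => hpp' y]
  have hle : |∫ x, (∑ y, |p (x, y) - joint f m (x, y)| - ∑ y, |p' (x, y) - joint f m' (x, y)|) ∂μ|
      ≤ ∫ x, 2 * ∑ y, |p (x, y) - p' (x, y)| ∂μ := by
    refine abs_integral_le_integral_abs.trans (integral_mono_ae
      ((hD p m hp hm).sub (hD p' m' hp' hm')).abs (hi.const_mul 2) ?_)
    filter_upwards [hf, hm, hm'] with x hx h1 h2
    simp only [joint, ← h1, ← h2]
    exact abs_sum_abs_sub_mul_sum_sub_le hx (fun y => p (x, y)) fun y => p' (x, y)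
  rw [integral_const_mul] at hle
  rw [abs_of_pos (by norm_num)]
  linarith

theorem sum_integral_abs_sub_le_two {p q : 𝒳 × 𝒴 → ℝ}
    (hp : ∀ y, Integrable (fun x => p (x, y)) μ) (hq : ∀ y, Integrable (fun x => q (x, y)) μ)
    (hp0 : ∀ᵐ x ∂μ, ∀ y, 0 ≤ p (x, y)) (hq0 : ∀ᵐ x ∂μ, ∀ y, 0 ≤ q (x, y))
    (hp1 : ∫ x, ∑ y, p (x, y) ∂μ = 1) (hq1 : ∫ x, ∑ y, q (x, y) ∂μ = 1) :
    ∑ y, ∫ x, |p (x, y) - q (x, y)| ∂μ ≤ 2 := by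
  have hpq : ∀ y, Integrable (fun x => |p (x, y) - q (x, y)|) μ := fun y =>
    ((hp y).sub (hq y)).abs
  rw [← integral_finsetSum _ fun y _ => hpq y]
  have hps : Integrable (fun x => ∑ y, p (x, y)) μ := integrable_finsetSum _ fun y _ => hp y
  have hqs : Integrable (fun x => ∑ y, q (x, y)) μ := integrable_finsetSum _ fun y _ => hq y
  calc ∫ x, ∑ y, |p (x, y) - q (x, y)| ∂μ ≤ ∫ x, (∑ y, p (x, y) + ∑ y, q (x, y)) ∂μ := by
        refine integral_mono_ae (integrable_finsetSum _ fun y _ => hpq y)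
          (hps.add hqs) ?_
        filter_upwards [hp0, hq0] with x h1 h2
        rw [← Finset.sum_add_distrib]
        refine Finset.sum_le_sum fun y _ => ?_
        have := h1 y
        have := h2 y
        exact abs_le.2 ⟨by linarith, by linarith⟩
    _ = 2 := by
        rw [integral_add hps hqs, hp1, hq1]
        norm_num

/-- Robustness: an estimate `p` of the contaminated function recovers the distance of `p₀` from `f`
times its marginal up to `2 ε` and the `L¹` error of estimation. Taking `μ` to be the counting
measure or Lebesgue measure covers discrete and continuous covariates. -/
theorem abs_tvd_sub_le_of_contaminated {f : 𝒳 → 𝒴 → ℝ}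
    (hfm : ∀ y, AEStronglyMeasurable (fun x => f x y) μ) (hf : ∀ᵐ x ∂μ, f x ∈ stdSimplex ℝ 𝒴)
    {p p₀ q : 𝒳 × 𝒴 → ℝ} (hp : ∀ y, Integrable (fun x => p (x, y)) μ)
    (hp₀ : ∀ y, Integrable (fun x => p₀ (x, y)) μ) (hq : ∀ y, Integrable (fun x => q (x, y)) μ)
    (hp0 : ∀ᵐ x ∂μ, ∀ y, 0 ≤ p₀ (x, y)) (hq0 : ∀ᵐ x ∂μ, ∀ y, 0 ≤ q (x, y))
    (hp1 : ∫ x, ∑ y, p₀ (x, y) ∂μ = 1) (hq1 : ∫ x, ∑ y, q (x, y) ∂μ = 1) {m m₀ : 𝒳 → ℝ}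
    (hm : ∀ᵐ x ∂μ, ∑ y, p (x, y) = m x) (hm₀ : ∀ᵐ x ∂μ, ∑ y, p₀ (x, y) = m₀ x)
    {ε : ℝ} (hε : 0 ≤ ε) :
    |1 / 2 * ∫ x, ∑ y, |p (x, y) - joint f m (x, y)| ∂μ
      - 1 / 2 * ∫ x, ∑ y, |p₀ (x, y) - joint f m₀ (x, y)| ∂μ|
    ≤ 2 * ε + ∑ y, ∫ x, |p (x, y) - contaminated ε p₀ q (x, y)| ∂μ := by
  refine (abs_tvd_joint_marginal_sub_le hfm hf hp hp₀ hm hm₀).trans ?_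
  have hc : ∀ y, Integrable (fun x => contaminated ε p₀ q (x, y)) μ := fun y =>
    ((hp₀ y).const_mul _).add ((hq y).const_mul _)
  calc ∑ y, ∫ x, |p (x, y) - p₀ (x, y)| ∂μ
      ≤ ∑ y, (ε * ∫ x, |p₀ (x, y) - q (x, y)| ∂μ
          + ∫ x, |p (x, y) - contaminated ε p₀ q (x, y)| ∂μ) := by
        refine Finset.sum_le_sum fun y _ => ?_
        have h1 : Integrable (fun x => ε * |p₀ (x, y) - q (x, y)|) μ :=
          ((hp₀ y).sub (hq y)).abs.const_mul ε
        have h2 : Integrable (fun x => |p (x, y) - contaminated ε p₀ q (x, y)|) μ :=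
          ((hp y).sub (hc y)).abs
        rw [← integral_const_mul, ← integral_add h1 h2]
        refine integral_mono ((hp y).sub (hp₀ y)).abs (h1.add h2) fun x => ?_
        simp only
        rw [← abs_of_nonneg hε, ← abs_mul, abs_of_nonneg hε, abs_sub_comm (p (x, y)) (p₀ (x, y)),
          abs_sub_comm (p (x, y)) (contaminated ε p₀ q (x, y))]
        refine le_trans (le_of_eq ?_) (abs_add_le _ _)
        rw [contaminated]
        ring_nf
    _ ≤ 2 * ε + ∑ y, ∫ x, |p (x, y) - contaminated ε p₀ q (x, y)| ∂μ := by
        rw [Finset.sum_add_distrib, ← Finset.mul_sum, mul_comm 2 ε]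
        gcongr
        exact sum_integral_abs_sub_le_two hp₀ hq hp0 hq0 hp1 hq1

end Stability

/-! ### Discrete covariates -/

section DiscreteCovariates

variable {Ω : Type*} [MeasurableSpace Ω] {P : Measure Ω} [IsProbabilityMeasure P]

theorem IsIIDOfPmf.ae_tendsto_frequency {α : Type*} [Countable α] [DecidableEq α] [MeasurableSpace α]
    [MeasurableSingletonClass α] {c : α → ℝ} {Z : ℕ → Ω → α} (h : IsIIDOfPmf P c Z) (w : α) :
    ∀ᵐ ω ∂P, Tendsto (fun n : ℕ => (1 / (n : ℝ)) * ∑ i ∈ Finset.range n,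
      if Z i ω = w then 1 else 0) atTop (𝓝 (c w)) := by
  have hφ : Measurable fun z : α => if z = w then (1 : ℝ) else 0 :=
    Measurable.ite (measurableSet_singleton w) measurable_const measurable_const
  have hX : ∀ i, Measurable fun ω => if Z i ω = w then (1 : ℝ) else 0 := fun i =>
    hφ.comp (h.measurable i)
  have hXind : ∀ i, (fun ω => if Z i ω = w then (1 : ℝ) else 0)
      = (Z i ⁻¹' {w}).indicator 1 := fun i => by
    ext ω
    by_cases hw : Z i ω = w <;> simp [hw]
  have hms : ∀ i, MeasurableSet (Z i ⁻¹' {w}) := fun i =>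
    h.measurable i (measurableSet_singleton w)
  have hident : ∀ i, IdentDistrib (fun ω => if Z i ω = w then (1 : ℝ) else 0)
      (fun ω => if Z 0 ω = w then (1 : ℝ) else 0) P P := fun i =>
    IdentDistrib.comp ⟨(h.measurable i).aemeasurable, (h.measurable 0).aemeasurable,
      Measure.ext_of_singleton fun a => by
        rw [Measure.map_apply (h.measurable i) (measurableSet_singleton a),
          Measure.map_apply (h.measurable 0) (measurableSet_singleton a),
          ← measureReal_eq_measureReal_iff, h.law, h.law]⟩ hφ
  have hlaw := strong_law_ae_real (fun i ω => if Z i ω = w then (1 : ℝ) else 0)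
    (Integrable.of_bound (hX 0).aestronglyMeasurable 1 (ae_of_all _ fun ω => by
      split_ifs <;> simp)) (fun i j hij => (h.indep.indepFun hij).comp hφ hφ) hident
  rw [hXind 0, integral_indicator_one (hms 0), h.law 0 w] at hlaw
  filter_upwards [hlaw] with ω hω
  refine hω.congr fun n => ?_
  rw [div_eq_inv_mul, one_div]

theorem ae_eventually_estDiscrete {𝒳 𝒴 : Type*} [Fintype 𝒳] [Fintype 𝒴] [DecidableEq 𝒳]
    [DecidableEq 𝒴] [MeasurableSpace 𝒳] [MeasurableSpace 𝒴] [MeasurableSingletonClass 𝒳]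
    [MeasurableSingletonClass 𝒴] {f₀ f : 𝒳 → 𝒴 → ℝ} (hf₀ : ∀ x, f₀ x ∈ stdSimplex ℝ 𝒴)
    (hf : ∀ x, f x ∈ stdSimplex ℝ 𝒴) {px : 𝒳 → ℝ} (hpx : px ∈ stdSimplex ℝ 𝒳)
    {q : 𝒳 × 𝒴 → ℝ} (hq : q ∈ stdSimplex ℝ (𝒳 × 𝒴)) {ε η : ℝ} (hε : 0 ≤ ε) (hη : 0 < η)
    {Z : ℕ → Ω → 𝒳 × 𝒴} (hZ : IsIIDOfPmf P (contaminated ε (joint f₀ px) q) Z) :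
    ∀ᵐ ω ∂P, ∀ᶠ n in atTop,
      |estDiscrete f (fun i => Z i ω) n - tvdDiscrete (joint f₀ px) (joint f px)| ≤ 2 * ε + η := by
  filter_upwards [ae_all_iff.2 fun w => hZ.ae_tendsto_frequency w] with ω hω
  set c := contaminated ε (joint f₀ px) q with hc
  have hlim : Tendsto (fun n => ∑ y, ∫ x, |empJoint (fun i => Z i ω) n (x, y) - c (x, y)|
      ∂(Measure.count : Measure 𝒳)) atTop (𝓝 0) := by
    simp only [integral_count]
    have : Tendsto (fun n => ∑ y, ∑ x, |empJoint (fun i => Z i ω) n (x, y) - c (x, y)|) atTop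
        (𝓝 (∑ y : 𝒴, ∑ x : 𝒳, |c (x, y) - c (x, y)|)) :=
      tendsto_finsetSum _ fun y _ => tendsto_finsetSum _ fun x _ => ((hω (x, y)).sub_const _).abs
    simpa using this
  filter_upwards [hlim.eventually (ge_mem_nhds hη)] with n hn
  have hmain := abs_tvd_sub_le_of_contaminated (μ := (Measure.count : Measure 𝒳)) (f := f)
    (fun y => (measurable_of_finite _).aestronglyMeasurable) (ae_of_all _ hf)
    (p := empJoint (fun i => Z i ω) n) (p₀ := joint f₀ px) (q := q)
    (fun y => .of_finite) (fun y => .of_finite) (fun y => .of_finite)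
    (ae_of_all _ fun x y => mul_nonneg ((hf₀ x).1 y) (hpx.1 x))
    (ae_of_all _ fun x y => hq.1 _)
    (by simp [integral_count, joint, ← Finset.sum_mul, (hf₀ _).2, hpx.2])
    (by rw [integral_count, ← Fintype.sum_prod_type]; exact hq.2)
    (m := empMarginal (fun i => Z i ω) n) (m₀ := px)
    (ae_of_all _ fun x => by
      simp only [empJoint, empMarginal]
      rw [← Finset.mul_sum, Finset.sum_comm]
      congr 1
      refine Finset.sum_congr rfl fun i _ => ?_
      by_cases hx : (Z i ω).1 = x
      · simp [hx, Prod.ext_iff]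
      · simp [hx, Prod.ext_iff])
    (ae_of_all _ fun x => by simp [joint, ← Finset.sum_mul, (hf₀ x).2]) hε
  simp only [integral_count] at hmain hn
  refine hmain.trans (add_le_add_right hn _)

end DiscreteCovariates

/-! ### Continuous covariates -/

section ContinuousCovariates

variable {d : ℕ} {𝒴 : Type*} [Fintype 𝒴] {S : Set (EuclideanSpace ℝ (Fin d))}

theorem IsDensityOn.integrable {m : EuclideanSpace ℝ (Fin d) → ℝ} (h : IsDensityOn S m) :
    Integrable m (volume.restrict S) :=
  integrable_of_integral_eq_one h.integral_eq_one

theorem IsJointDensityOn.integrable (hS : MeasurableSet S)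
    {q : EuclideanSpace ℝ (Fin d) × 𝒴 → ℝ} (h : IsJointDensityOn S q) (y : 𝒴) :
    Integrable (fun x => q (x, y)) (volume.restrict S) := by
  refine (integrable_of_integral_eq_one h.integral_eq_one).mono
    (h.measurable y).aestronglyMeasurable ?_
  filter_upwards [ae_restrict_mem hS] with x hx
  rw [Real.norm_of_nonneg (h.nonneg x hx y),
    Real.norm_of_nonneg (Finset.sum_nonneg fun i _ => h.nonneg x hx i)]
  exact Finset.single_le_sum (f := fun y => q (x, y)) (fun i _ => h.nonneg x hx i)
    (Finset.mem_univ y)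

variable [MeasurableSpace 𝒴] [MeasurableSingletonClass 𝒴]

/-- The density of the label `y` is extended by zero outside `S`, so that the consistency theorem,
which smooths over the whole space, applies. -/
theorem isLabelDensity_withDensity (hS : MeasurableSet S) {c : EuclideanSpace ℝ (Fin d) × 𝒴 → ℝ}
    (hc : ∀ y, Measurable fun x => c (x, y)) (y : 𝒴) :
    IsLabelDensity (((volume : Measure (EuclideanSpace ℝ (Fin d))).restrict S).prod
      (Measure.count : Measure 𝒴) |>.withDensity fun w => ENNReal.ofReal (c w)) volume y
      (S.indicator fun x => c (x, y)) := by
  have hcm : Measurable c := measurable_from_prod_countable_left hc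
  refine Measure.ext fun A hA => ?_
  have hs : MeasurableSet (Prod.snd ⁻¹' {y} : Set (EuclideanSpace ℝ (Fin d) × 𝒴)) :=
    measurable_snd (measurableSet_singleton y)
  have hset : Prod.fst ⁻¹' A ∩ Prod.snd ⁻¹' {y} = A ×ˢ ({y} : Set 𝒴) := rfl
  rw [Measure.map_apply measurable_fst hA, Measure.restrict_apply (measurable_fst hA), hset,
    withDensity_apply _ (hA.prod (measurableSet_singleton y)), withDensity_apply _ hA,
    ← Measure.prod_restrict, Measure.restrict_singleton, Measure.count_singleton, one_smul,
    lintegral_prod _ hcm.ennreal_ofReal.aemeasurable]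
  simp only [lintegral_dirac]
  rw [Measure.restrict_restrict hA, ← lintegral_indicator hA, ← lintegral_indicator (hA.inter hS)]
  refine lintegral_congr fun x => ?_
  by_cases h1 : x ∈ A <;> by_cases h2 : x ∈ S <;> simp [h1, h2]

variable {Ω : Type*} [MeasurableSpace Ω] {P : Measure Ω} [IsProbabilityMeasure P] [DecidableEq 𝒴]

theorem ae_eventually_estContinuous (hS : MeasurableSet S)
    {f₀ f : EuclideanSpace ℝ (Fin d) → 𝒴 → ℝ} (hf₀ : IsCondPmfOn S f₀) (hf : IsCondPmfOn S f)
    {px : EuclideanSpace ℝ (Fin d) → ℝ} (hpx : IsDensityOn S px)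
    {q : EuclideanSpace ℝ (Fin d) × 𝒴 → ℝ} (hq : IsJointDensityOn S q)
    {K : EuclideanSpace ℝ (Fin d) → ℝ} (hK : Measurable K) (hK1 : ∫ u, K u = 1)
    {h : ℕ → ℝ} (hpos : ∀ n, 0 < h n) (hlim : Tendsto h atTop (𝓝 0))
    (hrate : Tendsto (fun n : ℕ => (n : ℝ) * h n ^ d) atTop atTop)
    {ε η : ℝ} (hε : ε ∈ Set.Icc (0 : ℝ) 1) (hη : 0 < η)
    {Z : ℕ → Ω → EuclideanSpace ℝ (Fin d) × 𝒴}
    (hZ : IsIIDOfDensityOn P S (contaminated ε (joint f₀ px) q) Z) :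
    ∀ᵐ ω ∂P, ∀ᶠ n in atTop,
      |estContinuous S K (h n) f (fun i => Z i ω) n
        - tvdContinuous S (joint f₀ px) (joint f px)| ≤ 2 * ε + η := by
  set c := contaminated ε (joint f₀ px) q with hc
  have hKi : Integrable K := integrable_of_integral_eq_one hK1
  have hSae : ∀ᵐ x ∂(volume : Measure (EuclideanSpace ℝ (Fin d))).restrict S, x ∈ S :=
    ae_restrict_mem hS
  have hp₀i : ∀ y, Integrable (fun x => joint f₀ px (x, y)) (volume.restrict S) :=
    integrable_joint (fun y => (hf₀.measurable y).aestronglyMeasurable)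
      (hSae.mono fun x hx => hf₀.mem_simplex x hx) hpx.integrable
  have hci : ∀ y, Integrable (fun x => c (x, y)) (volume.restrict S) := fun y =>
    ((hp₀i y).const_mul _).add ((hq.integrable hS y).const_mul _)
  have hcm : ∀ y, Measurable fun x => c (x, y) := fun y =>
    (((hf₀.measurable y).mul hpx.measurable).const_mul _).add ((hq.measurable y).const_mul _)
  have hp₀0 : ∀ x ∈ S, ∀ y, 0 ≤ joint f₀ px (x, y) := fun x hx y =>
    mul_nonneg ((hf₀.mem_simplex x hx).1 y) (hpx.nonneg x hx)
  have hc0 : ∀ x ∈ S, ∀ y, 0 ≤ c (x, y) := fun x hx y =>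
    add_nonneg (mul_nonneg (sub_nonneg.2 hε.2) (hp₀0 x hx y))
      (mul_nonneg hε.1 (hq.nonneg x hx y))
  have hm₀ : ∀ x ∈ S, ∑ y, joint f₀ px (x, y) = px x := fun x hx => by
    simp [joint, ← Finset.sum_mul, (hf₀.mem_simplex x hx).2]
  have hrate' : Tendsto (fun n : ℕ => (n : ℝ) *
      h n ^ Module.finrank ℝ (EuclideanSpace ℝ (Fin d))) atTop atTop := by
    simpa using hrate
  have hcons : ∀ y, ∀ᵐ ω ∂P, _ := fun y =>
    ae_tendsto_integral_abs_mean_sub_density (μ := volume) (y := y) hZ.measurable hZ.indep hZ.law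
      (isLabelDensity_withDensity hS hcm y) ((hcm y).indicator hS)
      (Set.indicator_nonneg fun x hx => hc0 x hx y)
      ((integrable_indicator_iff hS).2 (hci y)) hK hKi hK1 hpos hlim hrate'
  have hkde : ∀ (z : ℕ → EuclideanSpace ℝ (Fin d) × 𝒴) n x y, kdeJoint K (h n) z n (x, y)
      = (1 / (n : ℝ)) * ∑ i ∈ Finset.range n, labelledKernel y (scaledKernel K (h n)) (z i) x := by
    intro z n x y
    simp [kdeJoint, labelledKernel, scaledKernel]
  have hkdei : ∀ (z : ℕ → EuclideanSpace ℝ (Fin d) × 𝒴) n y,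
      Integrable (fun x => kdeJoint K (h n) z n (x, y)) := fun z n y => by
    simp only [hkde]
    exact (integrable_finsetSum _ fun i _ => integrable_labelledKernel_right y
      (integrable_scaledKernel volume hK hKi (hpos n)) (z i)).const_mul _
  filter_upwards [ae_all_iff.2 hcons] with ω hω
  have hlimc : Tendsto (fun n => ∑ y, ∫ x in S,
      |kdeJoint K (h n) (fun i => Z i ω) n (x, y) - c (x, y)|) atTop (𝓝 0) := by
    have hsum := tendsto_finsetSum Finset.univ fun y _ => hω y
    rw [Finset.sum_const_zero] at hsum
    refine squeeze_zero (fun n => Finset.sum_nonneg fun y _ => integral_nonneg fun x =>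
      abs_nonneg _) (fun n => Finset.sum_le_sum fun y _ => ?_) hsum
    simp only [← hkde]
    calc ∫ x in S, |kdeJoint K (h n) (fun i => Z i ω) n (x, y) - c (x, y)|
        = ∫ x in S, |kdeJoint K (h n) (fun i => Z i ω) n (x, y)
            - S.indicator (fun x => c (x, y)) x| :=
          setIntegral_congr_fun hS fun x hx => by simp [hx]
      _ ≤ ∫ x, |kdeJoint K (h n) (fun i => Z i ω) n (x, y)
            - S.indicator (fun x => c (x, y)) x| :=
          setIntegral_le_integral
            ((hkdei _ n y).sub ((integrable_indicator_iff hS).2 (hci y))).abs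
            (ae_of_all _ fun x => abs_nonneg _)
  filter_upwards [hlimc.eventually (ge_mem_nhds hη)] with n hn
  have hmain := abs_tvd_sub_le_of_contaminated (μ := volume.restrict S) (f := f)
    (fun y => (hf.measurable y).aestronglyMeasurable)
    (hSae.mono fun x hx => hf.mem_simplex x hx)
    (p := kdeJoint K (h n) (fun i => Z i ω) n) (p₀ := joint f₀ px) (q := q)
    (fun y => (hkdei _ n y).restrict) hp₀i (hq.integrable hS)
    (hSae.mono fun x hx => hp₀0 x hx) (hSae.mono fun x hx => hq.nonneg x hx)
    ((setIntegral_congr_fun hS hm₀).trans hpx.integral_eq_one) hq.integral_eq_one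
    (m := kdeMarginal K (h n) (fun i => Z i ω) n) (m₀ := px) (ae_of_all _ fun x => rfl)
    (hSae.mono hm₀) hε.1
  exact hmain.trans (add_le_add_right hn _)

theorem labelCount_le {𝒳 : Type*} {𝒴 : Type*} [DecidableEq 𝒴] (z : ℕ → 𝒳 × 𝒴) (n : ℕ) (y : 𝒴) :
    labelCount z n y ≤ n :=
  (Finset.card_filter_le _ _).trans (Finset.card_range n).le

end ContinuousCovariates

end TVDRobust

theorem corollary2
    {Ω : Type*} [MeasurableSpace Ω] (P : Measure Ω) [IsProbabilityMeasure P]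
    {𝒴 : Type*} [Fintype 𝒴] [DecidableEq 𝒴] [MeasurableSpace 𝒴] [MeasurableSingletonClass 𝒴]
    {Θ : Type*} (θ₀ θ : Θ)
    (ε : ℝ) (hε : ε ∈ Set.Ioo (0 : ℝ) 1) (η : ℝ) (hη : 0 < η) :
    -- discrete covariates
    (∀ (𝒳 : Type*) [Fintype 𝒳] [DecidableEq 𝒳] [MeasurableSpace 𝒳] [MeasurableSingletonClass 𝒳]
      (f : Θ → 𝒳 → 𝒴 → ℝ) (_ : ∀ t x, f t x ∈ stdSimplex ℝ 𝒴)
      (px : 𝒳 → ℝ) (_ : px ∈ stdSimplex ℝ 𝒳)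
      (q : 𝒳 × 𝒴 → ℝ) (_ : q ∈ stdSimplex ℝ (𝒳 × 𝒴))
      (Z : ℕ → Ω → 𝒳 × 𝒴)
      (_ : TVDRobust.IsIIDOfPmf P (TVDRobust.contaminated ε (TVDRobust.joint (f θ₀) px) q) Z),
      ∀ᵐ ω ∂P, ∃ N : ℕ, ∀ n : ℕ, N ≤ n →
        |TVDRobust.estDiscrete (f θ) (fun i => Z i ω) n
          - TVDRobust.tvdDiscrete (TVDRobust.joint (f θ₀) px) (TVDRobust.joint (f θ) px)|
        ≤ 2 * ε + η) ∧
    -- kernel-smoothed estimator for continuous covariates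
    (∀ (d : ℕ) (S : Set (EuclideanSpace ℝ (Fin d))) (_ : MeasurableSet S)
      (f : Θ → EuclideanSpace ℝ (Fin d) → 𝒴 → ℝ) (_ : ∀ t, TVDRobust.IsCondPmfOn S (f t))
      (px : EuclideanSpace ℝ (Fin d) → ℝ) (_ : TVDRobust.IsDensityOn S px)
      (q : EuclideanSpace ℝ (Fin d) × 𝒴 → ℝ) (_ : TVDRobust.IsJointDensityOn S q)
      (K : EuclideanSpace ℝ (Fin d) → ℝ) (_ : Measurable K) (_ : ∫ u, K u = 1)
      (h : ℕ → ℝ) (_ : ∀ n, 0 < h n) (_ : Tendsto h atTop (𝓝 0))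
      (_ : Tendsto (fun n : ℕ => (n : ℝ) * h n ^ d) atTop atTop)
      (Z : ℕ → Ω → EuclideanSpace ℝ (Fin d) × 𝒴)
      (_ : TVDRobust.IsIIDOfDensityOn P S
        (TVDRobust.contaminated ε (TVDRobust.joint (f θ₀) px) q) Z),
      ∀ᵐ ω ∂P, ∃ N : ℕ, ∀ n : ℕ,
        (∀ y, N ≤ TVDRobust.labelCount (fun i => Z i ω) n y) →
        |TVDRobust.estContinuous S K (h n) (f θ) (fun i => Z i ω) n
          - TVDRobust.tvdContinuous S (TVDRobust.joint (f θ₀) px) (TVDRobust.joint (f θ) px)|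
        ≤ 2 * ε + η) := by
  refine ⟨?_, ?_⟩
  · intro 𝒳 _ _ _ _ f hf px hpx q hq Z hZ
    filter_upwards [TVDRobust.ae_eventually_estDiscrete (hf θ₀) (hf θ) hpx hq hε.1.le hη hZ]
      with ω hω using eventually_atTop.1 hω
  · intro d S hS f hf px hpx q hq K hK hK1 h hpos hlim hrate Z hZ
    filter_upwards [TVDRobust.ae_eventually_estContinuous hS (hf θ₀) (hf θ) hpx hq hK hK1 hpos
      hlim hrate ⟨hε.1.le, hε.2.le⟩ hη hZ] with ω hω
    obtain ⟨N, hN⟩ := eventually_atTop.1 hω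
    -- the label of any observation shows that at least one `n_y`, hence `n`, is at least `N`
    exact ⟨N, fun n hn => hN n ((hn (Z 0 ω).2).trans (TVDRobust.labelCount_le _ n _))⟩
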